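/- **Setting.** Let $4\le m\le n$ be integers, $X=\{1,\dots,n\}$, $B=\{1,\dots,m\}\subset X$, and let $d_0:B\times B\to\mathbb N$ satisfy $d_0(j,j)=0$, $d_0(j,k)=d_0(k,j)$, $d_0(j,k)\ge 1$ for $j\ne k$, and $d_0(j,k)\le n-1$. The inverse travel time problem asks for a simple graph $E$ with $n$ vertices, among them the $m$ nodes of $B$, whose graph distance satisfies $d_E(x,y)=d_0(x,y)$ for all $x,y\in B$ (with $d_E=\infty$ where there is no path). Let $N=n(n-1)/2$. Graphs on $X$ are identified with bit vectors $\vec e=(e(j,k))_{1\le j<k\le n}\in\{0,1\}^N$. Let $f(\vec e)=1$ if $\vec e$ is a solution, and $f(\vec e)=0$ otherwise. **Oracle.** ORACLE is the following circuit of NOT, CNOT and CCNOT gates on the qubits $E(j,k)$ ($1\le j<k\le n$), a target qubit $R$, and the ancillae $P(d,j)$ ($1\le d\le n-1$, $1\le j\le n$), $A(k)$, $F(k)$ ($1\le k\le n$), $T(o)$ ($o\in B$). Here AND with controls $c_1,\dots,c_k$ ($k\ge3$) and target $t$ is CCNOT$(c_1,c_2;F(1))$, CCNOT$(F(1),c_3;F(2))$,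 …, CCNOT$(F(k-2),c_k;t)$ followed by the uncomputation of the $F$'s, and OR is AND conjugated by NOT on all controls, with an extra NOT on the target. * PATHS$(o)$: for $j\ne o$ apply CNOT$(E(j,o);P(1,j))$. Then for $d=2,\dots,n-1$ and each $j\neq o$: apply CCNOT$(P(d-1,k),E(k,j);A(k))$ for all $k\ne o,j$; apply OR with controls $A(k)$ ($k\neq o,j$) and $P(d-1,j)$ and target $P(d,j)$; uncompute the $A(k)$. * TEST: for each $o\in B$, run PATHS$(o)$. For each $j\in B\setminus\{o\}$, with $d=d_0(j,o)$: if $d=1$ apply CNOT$(P(1,j);A(j))$, otherwise NOT$(P(d-1,j))$ and CCNOT$(P(d,j),P(d-1,j);A(j))$. Apply AND with controls $A(j)$ ($j\in B\setminus\{o\}$) and target $T(o)$. Then reverse all the steps before this AND, including PATHS$(o)$. * ORACLE: run TEST, AND with controls $T(o)$ ($o\in B$) and target $R$, and reversed TEST. **Algorithm.** GROVER-$L$ initializes all qubits to $|0\rangle$, applies NOT to $R$ and then a Hadamard gate to $R$ and to every $E(j,k)$, applies $L$ times ORACLE followed by the diffusion operator $2|\gamma_N\rangle\langle\gamma_N|-\mathrm{id}$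 on the qubits $E(j,k)$, where $|\gamma_N\rangle=2^{-N/2}\sum_{x\in\{0,1\}^N}|x\rangle$, and outputs the measured values $\vec e$ of the qubits $E(j,k)$. Let $L(\theta)=\lceil \frac{\pi}{4\theta}-\frac12\rceil$ if $0<\theta<\frac\pi8$, $L(\theta)=1$ if $\frac\pi8\le\theta<\frac\pi4$, and $L(\theta)=0$ if $\frac\pi4\le\theta<\frac\pi2$. The algorithm runs GROVER-$L$ for $L=0,1,2$ and then for $L=L(\theta_K)$, where $\theta_K\in(0,\pi/2)$ and $\sin\theta_K=\sqrt{K/2^N}$, for $K=2^{N-4},2^{N-5},\dots,2,1$ in this order. After each run it applies to the result $\vec e$ the following classical test. For each $o\in B$ put $p(1,j)=e(o,j)$ and, for $2\le d\le n-1$, let $p(d,j)=1$ if $p(d-1,j)=1$ or there is $k\ne o,j$ with $p(d-1,k)=e(k,j)=1$, and $p(d,j)=0$ otherwise. Accept if and only if for all $o\neq j$ in $B$, with $d=d_0(o,j)$: $p(1,j)=1$ when $d=1$, and $p(d-1,j)=0$, $p(d,j)=1$ when $d\ge2$. If the test accepts, the algorithm outputs $\vec e$ and halts. If no result is accepted,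 it outputs "no solution found". Its number of queries is the number of applications of ORACLE plus the number of applications of the classical test. **Theorem.** There is a universal constant $C>0$ such that the following holds for all $n,m,d_0$ as above. 1. Every $\vec e$ that the algorithm outputs is a solution of the problem. 2. If the problem has a solution, then with probability at least $1/2$ the algorithm outputs a solution after at most $$C\,2^{N/2}\Big(\frac{N^{1/2}-m}{e}\Big)^{-(N^{1/2}-m)/2}$$ queries. If $N^{1/2}\le m$, the second factor is read as $1$. 3. If the problem has a solution, $\delta\in(0,1)$, and $M>\log_2(1/\delta)$ is an integer, then $M$ independent runs of the algorithm find at least one solution with probability greater than $1-\delta$. 4. Each gate of ORACLE acts on distinct qubits, and ORACLE is a quantum oracle for the set of solutions: it maps $|\vec e\rangle\otimes|r\rangle\otimes|0\cdots0\rangle$ to $|\vec e\rangle\otimes|r+f(\vec e)\bmod 2\rangle\otimes|0\cdots0\rangle$ for all $\vec e\in\{0,1\}^N$ and $r\in\{0,1\}$. It uses at most $CN$ qubits and at most $Cn^2$ qubits in total, and at most $C\,m\,n^3$ gates. -/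

import Mathlib

namespace TravelTime

/-! ### The inverse travel time problem for graphs -/

/-- The data of the inverse travel time problem: `n` vertices, `m` observation nodes
(numbered by `Fin m`), and the prescribed distances `d₀`, with the standing assumptions
under which the algorithms are run. -/
structure DistanceData (n m : ℕ) where
  d₀ : Fin m → Fin m → ℕ
  four_le : 4 ≤ m
  m_le_n : m ≤ n
  self_eq : ∀ j, d₀ j j = 0
  symm : ∀ j k, d₀ j k = d₀ k j
  one_le : ∀ j k, j ≠ k → 1 ≤ d₀ j k
  le_pred : ∀ j k, d₀ j k ≤ n - 1

/-- The graph `E` on the finite vertex set `X`, with observation nodes `b 0, …, b (m-1)`, solves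
the inverse travel time problem: it has `n` vertices, and its extended graph distance
(equal to `⊤` where there is no path) is `d₀` on the observation nodes. -/
def Solves {m : ℕ} (n : ℕ) (d₀ : Fin m → Fin m → ℕ) {X : Type} [Fintype X] (E : SimpleGraph X)
    (b : Fin m ↪ X) : Prop :=
  Fintype.card X = n ∧ ∀ i j, E.edist (b i) (b j) = (d₀ i j : ℕ∞)

/-- The problem with data `D` has a solution (on some vertex set). -/
def DistanceData.Solvable {n m : ℕ} (D : DistanceData n m) : Prop :=
  ∃ (X : Type) (_ : Fintype X) (E : SimpleGraph X) (b : Fin m ↪ X), Solves n D.d₀ E b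

/-- The positions `(j, k)`, `j < k`, of an upper triangular adjacency matrix. -/
abbrev Edge (n : ℕ) : Type := {p : Fin n × Fin n // p.1 < p.2}

/-- A bit vector `(e(j,k))_{j<k}`. -/
abbrev EdgeVec (n : ℕ) : Type := Edge n → Bool

/-- `N = n(n-1)/2`, the number of bits of an `EdgeVec n`. -/
def edgeCount (n : ℕ) : ℕ := n * (n - 1) / 2

/-- The unordered position `{j, k}`, for `j ≠ k`. -/
def mkEdge {n : ℕ} (j k : Fin n) (h : j ≠ k) : Edge n :=
  if hlt : j < k then ⟨(j, k), hlt⟩ else ⟨(k, j), lt_of_le_of_ne (not_lt.mp hlt) h.symm⟩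

/-- The adjacency matrix `e(j,k)` extended to all `j, k` by symmetry, zero on the diagonal. -/
def adj {n : ℕ} (e : EdgeVec n) (j k : Fin n) : Bool :=
  if h : j ≠ k then e (mkEdge j k h) else false

theorem mkEdge_comm {n : ℕ} (j k : Fin n) (h : j ≠ k) : mkEdge j k h = mkEdge k j h.symm := by
  unfold mkEdge
  rcases lt_or_gt_of_ne h with hlt | hlt
  · rw [dif_pos hlt, dif_neg (not_lt.mpr hlt.le)]
  · rw [dif_neg (not_lt.mpr hlt.le), dif_pos hlt]

theorem adj_comm {n : ℕ} (e : EdgeVec n) (j k : Fin n) : adj e j k = adj e k j := by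
  unfold adj
  by_cases h : j = k
  · subst h; rfl
  · rw [dif_pos h, dif_pos (Ne.symm h), mkEdge_comm]

/-- The graph on `Fin n` specified by a bit vector. -/
def toGraph {n : ℕ} (e : EdgeVec n) : SimpleGraph (Fin n) where
  Adj j k := adj e j k = true
  symm := ⟨fun j k h => by rw [adj_comm]; exact h⟩
  loopless := ⟨fun j h => by simp [adj] at h⟩

/-- The observation node `j` as a vertex: the first `m` vertices are the observation nodes. -/
def obs {n m : ℕ} (D : DistanceData n m) : Fin m ↪ Fin n := Fin.castLEEmb D.m_le_n

/-- The graph specified by `e` is a solution. -/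
def IsSolution {n m : ℕ} (D : DistanceData n m) (e : EdgeVec n) : Prop :=
  Solves n D.d₀ (toGraph e) (obs D)

open Classical in
/-- The indicator function `f` of the set of solutions. -/
noncomputable def solutionBit {n m : ℕ} (D : DistanceData n m) (e : EdgeVec n) : Bool :=
  decide (IsSolution D e)

/-! ### The classical algorithms -/

/-- The table `p(d, j)`, `d ≥ 1`, computed by the classical shortest path algorithm from the
vertex `o`. The entry at `d = 0` is a placeholder that is never read. -/
def pathTable {n : ℕ} (e : EdgeVec n) (o : Fin n) : ℕ → Fin n → Bool
  | 0, _ => false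
  | 1, j => adj e o j
  | d + 2, j => pathTable e o (d + 1) j ||
      decide (∃ k, k ≠ o ∧ k ≠ j ∧ (pathTable e o (d + 1) k && adj e k j) = true)

/-- The bit `s(j)` computed, for the starting node `o`, by the classical test. -/
def distanceFlag {n m : ℕ} (D : DistanceData n m) (e : EdgeVec n) (o j : Fin m) : Bool :=
  let d := D.d₀ o j
  let p := pathTable e (obs D o)
  (decide (d = 1) && p 1 (obs D j)) ||
    (decide (2 ≤ d) && !(p (d - 1) (obs D j)) && p d (obs D j))

/-- The classical test: the conjunction over `o` of the bits `t(o)`, each of which is the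
conjunction over `j ≠ o` of the bits `s(j)`. -/
def classicalTest {n m : ℕ} (D : DistanceData n m) (e : EdgeVec n) : Bool :=
  decide (∀ o j : Fin m, j ≠ o → distanceFlag D e o j = true)

/-! ### Reversible gates and quantum states -/

/-- The gates NOT (target), CNOT (control, target), CCNOT (two controls, target). -/
inductive Gate (Q : Type) : Type
  | not (t : Q) : Gate Q
  | cnot (c t : Q) : Gate Q
  | ccnot (c₁ c₂ t : Q) : Gate Q

/-- The qubits that the gate operates on are distinct. -/
def Gate.WellFormed {Q : Type} : Gate Q → Prop
  | .not _ => True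
  | .cnot c t => c ≠ t
  | .ccnot c₁ c₂ t => c₁ ≠ c₂ ∧ c₁ ≠ t ∧ c₂ ≠ t

instance {Q : Type} [DecidableEq Q] (g : Gate Q) : Decidable g.WellFormed := by
  cases g <;> unfold Gate.WellFormed <;> infer_instance

/-- The action on bit strings of a gate. (A gate that is not well-formed acts as the identity.) -/
def Gate.act {Q : Type} [DecidableEq Q] (g : Gate Q) (x : Q → Bool) : Q → Bool :=
  if g.WellFormed then
    match g with
    | .not t => Function.update x t (!(x t))
    | .cnot c t => Function.update x t (xor (x t) (x c))
    | .ccnot c₁ c₂ t => Function.update x t (xor (x t) (x c₁ && x c₂))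
  else x

theorem Gate.act_act {Q : Type} [DecidableEq Q] (g : Gate Q) (x : Q → Bool) :
    g.act (g.act x) = x := by
  by_cases h : g.WellFormed
  · cases g with
    | not t => simp [Gate.act, h]
    | cnot c t =>
      have h' : c ≠ t := h
      simp [Gate.act, h, h']
    | ccnot c₁ c₂ t =>
      have h' : c₁ ≠ c₂ ∧ c₁ ≠ t ∧ c₂ ≠ t := h
      simp [Gate.act, h, h'.2.1, h'.2.2]
  · simp [Gate.act, h]

/-- A vector of the Hilbert space `(ℂ²)^{⊗ Q}`, by its coefficients `⟨x|ψ⟩` in the computational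
basis. -/
abbrev QState (Q : Type) : Type := (Q → Bool) → ℂ

/-- The computational basis state `|x⟩`. -/
def ket {Q : Type} [DecidableEq (Q → Bool)] (x : Q → Bool) : QState Q := Pi.single x 1

/-- The linear operator with `|x⟩ ↦ |g.act x⟩`; as `g.act` is an involution, the coefficient of
`|y⟩` in the image of `ψ` is the coefficient of `|g.act y⟩` in `ψ`. -/
def Gate.apply {Q : Type} [DecidableEq Q] (g : Gate Q) (ψ : QState Q) : QState Q :=
  fun y => ψ (g.act y)

/-- A circuit is a list of gates; the head of the list is applied first. As every gate is its own
inverse, the reversed list is the inverse circuit. -/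
abbrev Circuit (Q : Type) : Type := List (Gate Q)

def Circuit.run {Q : Type} [DecidableEq Q] (c : Circuit Q) (ψ : QState Q) : QState Q :=
  c.foldl (fun φ g => g.apply φ) ψ

/-- The AND operator on a list of controls, a list of ancillae and a target: for controls
`c₁, …, c_k` the gates are CCNOT(c₁, c₂; f₁), CCNOT(f₁, c₃; f₂), …, CCNOT(f_{k-2}, c_k; t) followed
by the uncomputation of `f_{k-2}, …, f₁`. -/
def andCircuit {Q : Type} : List Q → List Q → Q → Circuit Q
  | c₁ :: c₂ :: c₃ :: cs, f :: fs, t =>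
      [.ccnot c₁ c₂ f] ++ andCircuit (f :: c₃ :: cs) fs t ++ [.ccnot c₁ c₂ f]
  | [c₁, c₂], _, t => [.ccnot c₁ c₂ t]
  | _, _, _ => []

/-- The OR operator. -/
def orCircuit {Q : Type} (cs fs : List Q) (t : Q) : Circuit Q :=
  cs.map .not ++ andCircuit cs fs t ++ [.not t] ++ cs.map .not

/-! ### The oracle -/

/-- The values `d = 1, …, n - 1`. -/
abbrev Dist (n : ℕ) : Type := Finset.Icc 1 (n - 1)

/-- The qubits other than the `E(j,k)`: the target `R` and the ancillae. -/
inductive Work (n m : ℕ) : Type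
  | R : Work n m
  | P (d : Dist n) (j : Fin n) : Work n m
  | A (k : Fin n) : Work n m
  | F (k : Fin n) : Work n m
  | T (o : Fin m) : Work n m
  deriving DecidableEq, Fintype

/-- The quantum register: the qubits `E(j,k)`, `j < k`, and the qubits in `Work n m`. -/
abbrev Qubit (n m : ℕ) : Type := Edge n ⊕ Work n m

section Oracle

variable {n m : ℕ}

def qE (j k : Fin n) (h : j ≠ k) : Qubit n m := .inl (mkEdge j k h)
def qR : Qubit n m := .inr .R
def qP (d : Dist n) (j : Fin n) : Qubit n m := .inr (.P d j)
def qA (k : Fin n) : Qubit n m := .inr (.A k)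
def qF (k : Fin n) : Qubit n m := .inr (.F k)
def qT (o : Fin m) : Qubit n m := .inr (.T o)

/-- The list of the ancillae `F(1), …, F(n)`. -/
def fList (n m : ℕ) : List (Qubit n m) := (List.finRange n).map qF

/-- Computation of the ancillae `A(k)`, `k ≠ o, j`, in UPDATE; `d'` stands for `d - 1`. -/
def neighbourCircuit (o : Fin n) (d' : Dist n) (j : Fin n) : Circuit (Qubit n m) :=
  (List.finRange n).flatMap fun k =>
    if h : k ≠ j ∧ k ≠ o then [.ccnot (qP d' k) (qE k j h.1) (qA k)] else []

/-- UPDATE: computes `P(d, ·)` from `P(d', ·)`, where `d' = d - 1`. -/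
def updateCircuit (o : Fin n) (d' d : Dist n) : Circuit (Qubit n m) :=
  ((List.finRange n).filter (· ≠ o)).flatMap fun j =>
    neighbourCircuit o d' j ++
    orCircuit (((List.finRange n).filter fun k => k ≠ o ∧ k ≠ j).map qA ++ [qP d' j])
      (fList n m) (qP d j) ++
    (neighbourCircuit o d' j).reverse

theorem one_mem_dist {j o : Fin n} (h : j ≠ o) : 1 ∈ Finset.Icc 1 (n - 1) := by
  have h1 : j.val ≠ o.val := fun h' => h (Fin.ext h')
  have := j.isLt
  have := o.isLt
  simp only [Finset.mem_Icc]
  omega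

/-- PATHS: computes all `P(d, j)` for the starting vertex `o`. The index `i = 0, …, n - 3` of the
loop stands for `d = i + 2`. -/
def pathsCircuit (o : Fin n) : Circuit (Qubit n m) :=
  ((List.finRange n).flatMap fun j =>
    if h : j ≠ o then [.cnot (qE j o h) (qP ⟨1, one_mem_dist h⟩ j)] else []) ++
  (List.finRange (n - 2)).flatMap fun i =>
    updateCircuit o
      ⟨i.val + 1, by have := i.isLt; simp only [Finset.mem_Icc]; omega⟩
      ⟨i.val + 2, by have := i.isLt; simp only [Finset.mem_Icc]; omega⟩

/-- The part of TEST that computes in `A(j)`, `j ≠ o`, whether the distance of `j` and `o` is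
`d₀(j, o)`. -/
def flagCircuit (D : DistanceData n m) (o : Fin m) : Circuit (Qubit n m) :=
  (List.finRange m).flatMap fun j =>
    if h : j ≠ o then
      if h1 : D.d₀ j o = 1 then
        [.cnot (qP ⟨D.d₀ j o, Finset.mem_Icc.mpr ⟨D.one_le j o h, D.le_pred j o⟩⟩ (obs D j))
          (qA (obs D j))]
      else
        [.not (qP ⟨D.d₀ j o - 1, by
            have := D.one_le j o h; have := D.le_pred j o
            simp only [Finset.mem_Icc]; omega⟩ (obs D j)),
         .ccnot
          (qP ⟨D.d₀ j o, Finset.mem_Icc.mpr ⟨D.one_le j o h, D.le_pred j o⟩⟩ (obs D j))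
          (qP ⟨D.d₀ j o - 1, by
            have := D.one_le j o h; have := D.le_pred j o
            simp only [Finset.mem_Icc]; omega⟩ (obs D j))
          (qA (obs D j))]
    else []

/-- TEST. -/
def testCircuit (D : DistanceData n m) : Circuit (Qubit n m) :=
  (List.finRange m).flatMap fun o =>
    pathsCircuit (obs D o) ++
    flagCircuit D o ++
    andCircuit (((List.finRange m).filter (· ≠ o)).map fun j => qA (obs D j)) (fList n m) (qT o) ++
    (flagCircuit D o).reverse ++
    (pathsCircuit (obs D o)).reverse

/-- ORACLE. -/
def oracleCircuit (D : DistanceData n m) : Circuit (Qubit n m) :=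
  testCircuit D ++
  andCircuit ((List.finRange m).map qT) (fList n m) qR ++
  (testCircuit D).reverse

/-- The bit string of the register with `E(j,k) = e(j,k)`, `R = r` and all ancillae `0`. -/
def registerBits (m : ℕ) (e : EdgeVec n) (r : Bool) : Qubit n m → Bool
  | .inl a => e a
  | .inr .R => r
  | .inr _ => false

end Oracle

/-! ### Hadamard gates, diffusion, measurement -/

/-- The operator `M ⊗ id`, where the computational basis `Ω` is split as `A × B`. -/
def actOn {Ω A B : Type} [Fintype A] (s : Ω ≃ A × B) (M : Matrix A A ℂ) (ψ : Ω → ℂ) : Ω → ℂ :=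
  fun x => ∑ a, M (s x).1 a * ψ (s.symm (a, (s x).2))

/-- The matrix of the Hadamard gate. -/
noncomputable def hadamard : Matrix Bool Bool ℂ :=
  fun a b => if a && b then -((1 / Real.sqrt 2 : ℝ) : ℂ) else ((1 / Real.sqrt 2 : ℝ) : ℂ)

/-- The matrix of `H ⊗ ⋯ ⊗ H`, with one factor for each element of `ι`. -/
noncomputable def hadamardPow (ι : Type) [Fintype ι] : Matrix (ι → Bool) (ι → Bool) ℂ :=
  fun x y => ∏ i, hadamard (x i) (y i)

/-- The uniform superposition `|γ⟩` of the computational basis states. -/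
noncomputable def uniformState (ι : Type) [Fintype ι] : (ι → Bool) → ℂ :=
  fun _ => ((1 / Real.sqrt (2 ^ Fintype.card ι) : ℝ) : ℂ)

/-- The matrix of `2|γ⟩⟨γ| - id`. -/
noncomputable def diffusionMatrix (ι : Type) [Fintype ι] [DecidableEq ι] :
    Matrix (ι → Bool) (ι → Bool) ℂ :=
  2 • Matrix.vecMulVec (uniformState ι) (star (uniformState ι)) - 1

/-- The splitting of the basis into the bits of the qubits `E(j,k)` and the other bits. -/
def splitEdges (n m : ℕ) : (Qubit n m → Bool) ≃ (Edge n → Bool) × (Work n m → Bool) :=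
  Equiv.sumArrowEquivProdArrow (Edge n) (Work n m) Bool

section Grover

variable {n m : ℕ}

/-- The state of the register before the first iteration: NOT on `R`, then a Hadamard gate on `R`
and on every `E(j,k)`, applied to `|0⋯0⟩`. -/
noncomputable def initialState (n m : ℕ) : QState (Qubit n m) :=
  actOn (splitEdges n m) (hadamardPow (Edge n))
    (actOn (Equiv.funSplitAt (qR : Qubit n m) Bool) hadamard
      ((Gate.not (qR : Qubit n m)).apply (ket fun _ => false)))

/-- One iteration: ORACLE followed by DIFFUSION on the qubits `E(j,k)`. -/
noncomputable def groverStep (D : DistanceData n m) (ψ : QState (Qubit n m)) :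
    QState (Qubit n m) :=
  actOn (splitEdges n m) (diffusionMatrix (Edge n)) ((oracleCircuit D).run ψ)

/-- The state immediately before the measurement in GROVER-L. -/
noncomputable def groverState (D : DistanceData n m) (L : ℕ) : QState (Qubit n m) :=
  (groverStep D)^[L] (initialState n m)

/-- The vector is a unit vector. -/
def IsNormalized {Ω : Type} [Fintype Ω] (ψ : Ω → ℂ) : Prop := ∑ x, ‖ψ x‖ ^ 2 = 1

theorem sum_sq_mulVec {A : Type} [Fintype A] [DecidableEq A] (M : Matrix A A ℂ)
    (hM : M.conjTranspose * M = 1) (v : A → ℂ) :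
    ∑ a, ‖(M.mulVec v) a‖ ^ 2 = ∑ a, ‖v a‖ ^ 2 := by
  have key : ∀ w : A → ℂ, ((∑ a, ‖w a‖ ^ 2 : ℝ) : ℂ) = star w ⬝ᵥ w := by
    intro w
    simp only [dotProduct, Pi.star_apply, Complex.ofReal_sum, Complex.ofReal_pow]
    refine Finset.sum_congr rfl fun a _ => ?_
    rw [← Complex.conj_mul']
    rfl
  have h : star (M.mulVec v) ⬝ᵥ M.mulVec v = star v ⬝ᵥ v := by
    rw [Matrix.star_mulVec, Matrix.dotProduct_mulVec, Matrix.vecMul_vecMul, hM, Matrix.vecMul_one]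
  rw [← key, ← key] at h
  exact_mod_cast h

theorem IsNormalized.actOn {Ω A B : Type} [Fintype Ω] [Fintype A] [DecidableEq A] [Fintype B]
    (s : Ω ≃ A × B) (M : Matrix A A ℂ) (hM : M.conjTranspose * M = 1) {ψ : Ω → ℂ}
    (h : IsNormalized ψ) : IsNormalized (actOn s M ψ) := by
  unfold IsNormalized at *
  rw [← h, ← s.symm.sum_comp, ← s.symm.sum_comp (fun x => ‖ψ x‖ ^ 2),
    Fintype.sum_prod_type_right, Fintype.sum_prod_type_right]
  refine Finset.sum_congr rfl fun b _ => ?_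
  rw [← sum_sq_mulVec M hM fun a => ψ (s.symm (a, b))]
  simp [TravelTime.actOn, Matrix.mulVec, dotProduct]

theorem IsNormalized.gate {Q : Type} [Fintype Q] [DecidableEq Q] (g : Gate Q) {ψ : QState Q}
    (h : IsNormalized ψ) : IsNormalized (g.apply ψ) := by
  unfold IsNormalized at *
  rw [← h]
  exact (Equiv.sum_comp ⟨g.act, g.act, g.act_act, g.act_act⟩ fun x => ‖ψ x‖ ^ 2)

theorem IsNormalized.run {Q : Type} [Fintype Q] [DecidableEq Q] (c : Circuit Q) {ψ : QState Q}
    (h : IsNormalized ψ) : IsNormalized (c.run ψ) := by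
  unfold Circuit.run
  induction c generalizing ψ with
  | nil => exact h
  | cons g c ih => exact ih (h.gate g)

theorem hadamard_unitary : hadamard.conjTranspose * hadamard = 1 := by
  have h2 : ((Real.sqrt 2 : ℝ) : ℂ) * (Real.sqrt 2 : ℝ) = 2 := by
    rw [← Complex.ofReal_mul, Real.mul_self_sqrt (by norm_num)]; simp
  have h : ((Real.sqrt 2 : ℝ) : ℂ)⁻¹ * ((Real.sqrt 2 : ℝ) : ℂ)⁻¹ = 1 / 2 := by
    rw [← mul_inv, h2]; norm_num
  ext a b
  cases a <;> cases b <;>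
    (simp [Matrix.mul_apply, Matrix.conjTranspose_apply, hadamard, h]; try norm_num)

theorem hadamardPow_unitary (ι : Type) [Fintype ι] [DecidableEq ι] :
    (hadamardPow ι).conjTranspose * hadamardPow ι = 1 := by
  ext x y
  have h : ((hadamardPow ι).conjTranspose * hadamardPow ι) x y =
      ∏ i, (hadamard.conjTranspose * hadamard) (x i) (y i) := by
    simp only [Matrix.mul_apply, Matrix.conjTranspose_apply, hadamardPow, star_prod,
      ← Finset.prod_mul_distrib]
    rw [Finset.prod_univ_sum, Fintype.piFinset_univ]
  rw [h, hadamard_unitary]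
  simp only [Matrix.one_apply]
  by_cases hxy : x = y
  · simp [hxy]
  · rw [if_neg hxy]
    obtain ⟨i, hi⟩ := Function.ne_iff.mp hxy
    exact Finset.prod_eq_zero (Finset.mem_univ i) (if_neg hi)

theorem diffusionMatrix_unitary (ι : Type) [Fintype ι] [DecidableEq ι] :
    (diffusionMatrix ι).conjTranspose * diffusionMatrix ι = 1 := by
  set P := Matrix.vecMulVec (uniformState ι) (star (uniformState ι)) with hP
  have hH : P.conjTranspose = P := by
    rw [hP, Matrix.conjTranspose_vecMulVec, star_star]
  have hn : star (uniformState ι) ⬝ᵥ uniformState ι = 1 := by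
    have h2 : (0 : ℝ) < 2 ^ Fintype.card ι := by positivity
    simp only [dotProduct, uniformState, Pi.star_apply, RCLike.star_def, Complex.conj_ofReal,
      ← Complex.ofReal_mul, Finset.sum_const, Finset.card_univ, Fintype.card_fun, Fintype.card_bool]
    rw [div_mul_div_comm, Real.mul_self_sqrt h2.le]
    simp
  have hPP : P * P = P := by
    rw [hP, Matrix.vecMulVec_mul_vecMulVec, hn]
    simp
  unfold diffusionMatrix
  rw [← hP, Matrix.conjTranspose_sub, Matrix.conjTranspose_smul, hH]
  simp only [star_ofNat, Matrix.conjTranspose_one, sub_mul, mul_sub, smul_mul_assoc,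
    mul_smul_comm, hPP, one_mul, mul_one]
  simp only [two_smul]
  abel

theorem initialState_normalized : IsNormalized (initialState n m) := by
  refine .actOn _ _ (hadamardPow_unitary _) (.actOn _ _ hadamard_unitary (.gate _ ?_))
  unfold IsNormalized ket
  rw [Finset.sum_eq_single (fun _ => false)]
  · simp
  · intro b _ hb
    simp [hb]
  · simp

theorem groverState_normalized (D : DistanceData n m) (L : ℕ) :
    IsNormalized (groverState D L) := by
  unfold groverState
  induction L with
  | zero => exact initialState_normalized
  | succ L ih =>
    rw [Function.iterate_succ_apply']
    exact .actOn _ _ (diffusionMatrix_unitary _) (.run _ ih)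

/-- The law of the result of measuring the qubits `E(j,k)` in the state `ψ`. -/
noncomputable def measureEdges (ψ : QState (Qubit n m)) (h : IsNormalized ψ) : PMF (EdgeVec n) :=
  PMF.ofFintype (fun e => ENNReal.ofReal (∑ w : Work n m → Bool, ‖ψ (Sum.elim e w)‖ ^ 2)) (by
    rw [← ENNReal.ofReal_sum_of_nonneg fun e _ => Finset.sum_nonneg fun w _ => by positivity]
    have h' : ∑ x, ‖ψ x‖ ^ 2 = 1 := h
    rw [← (splitEdges n m).symm.sum_comp, Fintype.sum_prod_type] at h'
    exact (congrArg ENNReal.ofReal h').trans ENNReal.ofReal_one)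

/-- GROVER-L: the law of its output. -/
noncomputable def groverL (D : DistanceData n m) (L : ℕ) : PMF (EdgeVec n) :=
  measureEdges (groverState D L) (groverState_normalized D L)

/-! ### The algorithm with an unknown number of solutions -/

/-- The function `L(θ)`. -/
noncomputable def iterations (θ : ℝ) : ℕ :=
  if θ < Real.pi / 8 then ⌈Real.pi / (4 * θ) - 1 / 2⌉₊
  else if θ < Real.pi / 4 then 1
  else 0

/-- The values of `L` that the algorithm uses, in this order: `0, 1, 2`, and then `L(θ)` with
`sin θ = √(K / 2 ^ N)` for `K = 2 ^ (N-4), …, 2, 1`. -/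
noncomputable def schedule (n : ℕ) : List ℕ :=
  [0, 1, 2] ++ (List.range (edgeCount n - 3)).reverse.map fun k =>
    iterations (Real.arcsin (Real.sqrt ((2 : ℝ) ^ k / (2 : ℝ) ^ edgeCount n)))

/-- The outcome of a run: the output (`none` for `no solution found`), the number of queries to
ORACLE and the number of calls of the classical test. -/
structure Outcome (n : ℕ) : Type where
  output : Option (EdgeVec n)
  oracleQueries : ℕ
  testQueries : ℕ

/-- Run GROVER-L for the listed values of `L` until the classical test accepts a result.
GROVER-L queries ORACLE `L` times. -/
noncomputable def attempts (D : DistanceData n m) : List ℕ → PMF (Outcome n)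
  | [] => PMF.pure ⟨none, 0, 0⟩
  | L :: Ls => (groverL D L).bind fun e =>
      if classicalTest D e then PMF.pure ⟨some e, L, 1⟩
      else (attempts D Ls).map fun r => ⟨r.output, r.oracleQueries + L, r.testQueries + 1⟩

/-- The law of the outcome of the quantum algorithm for the inverse travel time problem. -/
noncomputable def algorithm (D : DistanceData n m) : PMF (Outcome n) := attempts D (schedule n)

/-- The law of the list of outcomes of `M` independent runs of the algorithm. -/
noncomputable def repeated (D : DistanceData n m) : ℕ → PMF (List (Outcome n))
  | 0 => PMF.pure []
  | M + 1 => (algorithm D).bind fun r => (repeated D M).map fun rs => r :: rs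

/-- The run has found a solution. -/
def Outcome.Finds (D : DistanceData n m) (r : Outcome n) : Prop :=
  ∃ e, r.output = some e ∧ IsSolution D e

/-- The query bound `2^{N/2} ((√N - m)/e)^{-(√N - m)/2}`, where for `√N < m` (when the expression is
not defined) `√N - m` is replaced by `0`. Note that `0 ^ 0 = 1`. -/
noncomputable def queryBound (n m : ℕ) : ℝ :=
  let x : ℝ := max (Real.sqrt (edgeCount n) - m) 0
  (2 : ℝ) ^ ((edgeCount n : ℝ) / 2) * (x / Real.exp 1) ^ (-x / 2)

end Grover

end TravelTime

/-! Correctness of outputs is breadth-first search: away from `o` the table entry `p(d, j)` says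
that `j` is within distance `d` of `o`, so the classical test accepts exactly the solutions
(`classicalTest_eq_true_iff`), and only accepted vectors are output.

Gates permute bit strings, so ORACLE is analysed as a reversible classical program. Each loop
consists of blocks that change disjoint sets of qubits (`act_flatMap`), and a reversed block
uncomputes because only qubits that it ignores were changed in between. This gives
`oracleCircuit_act`. With the target in the state `(|0⟩ - |1⟩)/√2`, the oracle becomes a sign change
on solutions. Sign change and diffusion together rotate by `2θ`, where `sin² θ = K / 2^N` and `K` is
the number of solutions, so `L` iterations succeed with probability `sin² ((2L+1)θ)`
(`groverL_success`).

The schedule need not know `K`. If `K` is at least `2^(N-4)`, one of `L = 0, 1, 2` brings `(2L+1)θ`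
into `[π/4, 3π/4]`. Otherwise the scheduled power of two just above `K` has an angle between `θ` and
`2θ`, which is accurate enough. The costs up to that point are dominated by a geometric series and
total `O(√(2^N / K))` (`exists_attempt`). Earlier runs do no harm: they either halt with a solution
or are followed by the good run (`attempts_success`).

The query bound thus needs a lower bound for `K`. A solvable problem has a solution in which
vertices are determined by their distances to the nodes: while two vertices share these distances,
one of them can be detached and rehung as a leaf at a new distance (`exists_graph_separating`,
`exists_graph_injective`). Permuting the unobserved vertices of such a graph gives `(n-m)!`
different labelled solutions (`factorial_le_card_solutions`), and `(x/e)^x ≤ M!` for `0 ≤ x ≤ M`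
turns this into the stated bound. -/

namespace TravelTime

/-! ### The classical action of circuits -/

/-- The action on bit strings of a circuit. -/
def Circuit.act {Q : Type} [DecidableEq Q] (c : Circuit Q) (x : Q → Bool) : Q → Bool :=
  c.foldl (fun y g => g.act y) x

section Circuits

variable {Q : Type} [DecidableEq Q]

@[simp] theorem Circuit.act_nil (x : Q → Bool) : Circuit.act [] x = x := rfl

@[simp] theorem Circuit.act_cons (g : Gate Q) (c : Circuit Q) (x : Q → Bool) :
    Circuit.act (g :: c) x = Circuit.act c (g.act x) := rfl

@[simp] theorem Circuit.act_append (c c' : Circuit Q) (x : Q → Bool) :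
    Circuit.act (c ++ c') x = Circuit.act c' (Circuit.act c x) := by
  simp [Circuit.act, List.foldl_append]

theorem Circuit.act_reverse_act (c : Circuit Q) (x : Q → Bool) :
    Circuit.act c.reverse (Circuit.act c x) = x := by
  induction c generalizing x with
  | nil => rfl
  | cons g c ih => simp [ih, Gate.act_act]

theorem Circuit.act_act_reverse (c : Circuit Q) (x : Q → Bool) :
    Circuit.act c (Circuit.act c.reverse x) = x := by
  simpa using Circuit.act_reverse_act c.reverse x

theorem Circuit.act_reverse_eq {c : Circuit Q} {x y : Q → Bool} (h : Circuit.act c x = y) :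
    Circuit.act c.reverse y = x := by
  rw [← h, Circuit.act_reverse_act]

/-- Each gate acts on coefficients by precomposition with an involution, so the order of the gates
is reversed on arguments. This reduces quantum circuits to their action on bit strings. -/
theorem Circuit.run_apply (c : Circuit Q) (ψ : QState Q) (y : Q → Bool) :
    c.run ψ y = ψ (Circuit.act c.reverse y) := by
  induction c generalizing ψ with
  | nil => rfl
  | cons g c ih =>
    have : Circuit.run (g :: c) ψ = Circuit.run c (g.apply ψ) := rfl
    rw [this, ih]
    simp [Gate.apply]

theorem Circuit.run_ket [DecidableEq (Q → Bool)] (c : Circuit Q) (x : Q → Bool) :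
    c.run (ket x) = ket (Circuit.act c x) := by
  funext y
  rw [Circuit.run_apply]
  unfold ket
  have : Circuit.act c.reverse y = x ↔ y = Circuit.act c x :=
    ⟨fun h => by rw [← h, Circuit.act_act_reverse], fun h => by rw [h, Circuit.act_reverse_act]⟩
  simp [Pi.single_apply, this]

theorem Gate.act_not (t : Q) (x : Q → Bool) :
    (Gate.not t).act x = Function.update x t (!(x t)) := by
  simp [Gate.act, Gate.WellFormed]

theorem Gate.act_cnot {c t : Q} (h : c ≠ t) (x : Q → Bool) :
    (Gate.cnot c t).act x = Function.update x t (xor (x t) (x c)) := by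
  simp [Gate.act, Gate.WellFormed, h]

theorem Gate.act_ccnot {c₁ c₂ t : Q} (h₁₂ : c₁ ≠ c₂) (h₁ : c₁ ≠ t) (h₂ : c₂ ≠ t) (x : Q → Bool) :
    (Gate.ccnot c₁ c₂ t).act x = Function.update x t (xor (x t) (x c₁ && x c₂)) := by
  simp [Gate.act, Gate.WellFormed, h₁₂, h₁, h₂]

/-- The AND operator flips the target if all controls are on. -/
theorem andCircuit_act (cs fs : List Q) (t : Q) (x : Q → Bool) (h2 : 2 ≤ cs.length)
    (hlen : cs.length ≤ fs.length + 2) (hnd : (cs ++ fs).Nodup) (htc : t ∉ cs) (htf : t ∉ fs)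
    (hf : ∀ f ∈ fs, x f = false) :
    Circuit.act (andCircuit cs fs t) x = Function.update x t (xor (x t) (cs.all x)) := by
  induction cs, fs, t using andCircuit.induct generalizing x with
  | case1 c₁ c₂ c₃ cs f fs t ih =>
    simp only [andCircuit, Circuit.act_append, Circuit.act_cons, Circuit.act_nil]
    simp only [List.cons_append, List.nodup_cons, List.mem_cons, List.mem_append, not_or,
      List.nodup_append, forall_eq_or_imp] at hnd htc htf hf
    obtain ⟨⟨h12, h13, h1c, h1f, h1fs⟩, ⟨h23, h2c, h2f, h2fs⟩, ⟨h3c, h3f, h3fs⟩, hcs, ⟨hff, hfs⟩,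
      hdis⟩ := hnd
    have hfne : ∀ g ∈ fs, g ≠ f := fun g hg h => hff (h ▸ hg)
    have hx : (Gate.ccnot c₁ c₂ f).act x = Function.update x f (x c₁ && x c₂) := by
      rw [Gate.act_ccnot h12 h1f h2f, hf.1, Bool.false_xor]
    -- With `f = c₁ ∧ c₂` stored, the remaining circuit is the AND of `f, c₃, …`; neither it nor the
    -- target touches `c₁`, `c₂`, so the last CCNOT clears `f`.
    rw [hx, ih]
    · rw [Gate.act_ccnot h12 h1f h2f]
      have hall : cs.all (Function.update x f (x c₁ && x c₂)) = cs.all x := by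
        rw [Bool.eq_iff_iff, List.all_eq_true, List.all_eq_true]
        refine forall₂_congr fun a ha => ?_
        rw [Function.update_of_ne (hdis a ha).1]
      have htf' : f ≠ t := Ne.symm htf.1
      funext q
      by_cases hqf : q = f
      · subst hqf
        simp [h1f, h2f, hf.1, htf', Ne.symm htc.1, Ne.symm htc.2.1]
      · by_cases hqt : q = t
        · subst hqt
          simp [hqf, hall, Function.update_of_ne h3f, Bool.and_assoc]
        · simp [hqf, hqt]
    · simp
    · simp at hlen ⊢; omega
    · simp only [List.cons_append, List.nodup_cons, List.mem_cons, List.mem_append, not_or,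
        List.nodup_append]
      refine ⟨⟨Ne.symm h3f, fun h => (hdis f h).1 rfl, hff⟩, ⟨h3c, h3fs⟩, hcs, hfs, fun a ha b hb => (hdis a ha).2 b hb⟩
    · simp only [List.mem_cons, not_or]
      exact ⟨htf.1, htc.2.2.1, htc.2.2.2⟩
    · exact htf.2
    · intro g hg
      rw [Function.update_of_ne (hfne g hg)]
      exact hf.2 g hg
  | case2 c₁ c₂ fs t =>
    simp only [andCircuit, Circuit.act_cons, Circuit.act_nil]
    simp only [List.cons_append, List.nodup_cons, List.mem_cons, not_or, List.mem_append] at hnd htc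
    rw [Gate.act_ccnot hnd.1.1 (Ne.symm htc.1) (Ne.symm htc.2.1)]
    simp
  -- The default branch of `andCircuit` means fewer than two controls or too few ancillae; the
  -- length hypotheses exclude both.
  | case3 fs cs t h1 h2' =>
    exfalso
    match cs, fs, h1, h2', h2, hlen with
    | [], _, _, _, h, _ => simp at h
    | [_], _, _, _, h, _ => simp at h
    | [c₁, c₂], _, h, _, _, _ => exact h c₁ c₂ rfl
    | c₁ :: c₂ :: c₃ :: cs, f :: fs, _, h, _, _ => exact h c₁ c₂ c₃ cs f fs rfl rfl
    | c₁ :: c₂ :: c₃ :: cs, [], _, _, _, h => simp at h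

theorem act_map_not (cs : List Q) (x : Q → Bool) (hnd : cs.Nodup) :
    Circuit.act (cs.map .not) x = fun q => if q ∈ cs then !(x q) else x q := by
  induction cs generalizing x with
  | nil => simp
  | cons c cs ih =>
    simp only [List.nodup_cons] at hnd
    simp only [List.map_cons, Circuit.act_cons, Gate.act_not]
    rw [ih _ hnd.2]
    funext q
    by_cases hq : q = c
    · subst hq; simp [hnd.1]
    · simp [hq]

/-- The OR operator flips the target if some control is on. -/
theorem orCircuit_act (cs fs : List Q) (t : Q) (x : Q → Bool) (h2 : 2 ≤ cs.length)
    (hlen : cs.length ≤ fs.length + 2) (hnd : (cs ++ fs).Nodup) (htc : t ∉ cs) (htf : t ∉ fs)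
    (hf : ∀ f ∈ fs, x f = false) :
    Circuit.act (orCircuit cs fs t) x = Function.update x t (xor (x t) (cs.any x)) := by
  have hnd' := List.nodup_append.mp hnd
  unfold orCircuit
  simp only [Circuit.act_append, Circuit.act_cons, Circuit.act_nil]
  rw [act_map_not _ _ hnd'.1, andCircuit_act cs fs t _ h2 hlen hnd htc htf, Gate.act_not,
    act_map_not _ _ hnd'.1]
  · funext q
    have hall : cs.all (fun q => if q ∈ cs then !(x q) else x q) = !(cs.any x) := by
      rw [Bool.eq_iff_iff]
      simp +contextual [List.all_eq_true, List.any_eq_false]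
    by_cases hq : q = t
    · subst hq
      simp [htc, hall]
    · by_cases hc : q ∈ cs <;> simp [hq, hc]
  · intro f hf'
    have : f ∉ cs := fun h => hnd'.2.2 f h f hf' rfl
    rw [act_map_not _ _ hnd'.1]
    simp [this, hf f hf']

/-- Consecutive blocks that act on disjoint sets of qubits: `own q = some i` means that only the
block `i` may change `q`, and `z` is the final state. -/
theorem act_flatMap {ι : Type} [DecidableEq ι] (l : List ι) (c : ι → Circuit Q) (own : Q → Option ι)
    (x z : Q → Bool) (hl : l.Nodup)
    (h1 : ∀ i ∈ l, ∀ y : Q → Bool, (∀ q, (∀ j ∈ l, own q = some j → j = i) → y q = x q) →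
      Circuit.act (c i) y = fun q => if own q = some i then z q else y q)
    (h2 : ∀ q, (∀ i ∈ l, own q ≠ some i) → z q = x q) :
    Circuit.act (l.flatMap c) x = z := by
  induction l generalizing x with
  | nil => funext q; simpa using (h2 q (by simp)).symm
  | cons i l ih =>
    simp only [List.flatMap_cons, Circuit.act_append]
    rw [h1 i (by simp) x (fun _ _ => rfl)]
    simp only [List.nodup_cons] at hl
    refine ih _ hl.2 ?_ ?_
    · intro j hj y hy
      refine h1 j (by simp [hj]) y ?_
      intro q hq
      have hji : i ≠ j := fun h => hl.1 (h ▸ hj)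
      -- A qubit on which block `j` may rely is not owned by `i`, so the first block has left its
      -- initial value in place.
      rw [hy q fun k hk => hq k (by simp [hk]), if_neg]
      exact fun h => hji (hq i (by simp) h)
    · intro q hq
      split_ifs with h
      · rfl
      · exact h2 q (by simpa [h] using hq)

/-- Consecutive blocks that take each state of a sequence to the next one. -/
theorem act_flatMap_finRange (N : ℕ) (c : Fin N → Circuit Q) (S : ℕ → Q → Bool)
    (h : ∀ i : Fin N, Circuit.act (c i) (S i) = S (i + 1)) :
    Circuit.act ((List.finRange N).flatMap c) (S 0) = S N := by
  induction N generalizing S with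
  | zero => simp
  | succ N ih =>
    rw [List.finRange_succ, List.flatMap_cons, Circuit.act_append, List.flatMap_map]
    have h0 := h 0
    simp only [Fin.val_zero, zero_add] at h0
    rw [h0]
    exact ih (fun i => c i.succ) (fun k => S (k + 1)) fun i => by simpa using h i.succ

end Circuits

/-! ### Well-formedness and size of AND and OR. -/

section

variable {Q : Type}

theorem andCircuit_wellFormed (cs fs : List Q) (t : Q) (hnd : (cs ++ fs).Nodup) (htc : t ∉ cs)
    (htf : t ∉ fs) : ∀ g ∈ andCircuit cs fs t, g.WellFormed := by
  induction cs, fs, t using andCircuit.induct with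
  | case1 c₁ c₂ c₃ cs f fs t ih =>
    simp only [List.cons_append, List.nodup_cons, List.mem_cons, List.mem_append, not_or,
      List.nodup_append, forall_eq_or_imp] at hnd htc htf ih
    obtain ⟨⟨h12, h13, h1c, h1f, h1fs⟩, ⟨h23, h2c, h2f, h2fs⟩, ⟨h3c, h3f, h3fs⟩, hcs, ⟨hff, hfs⟩,
      hdis⟩ := hnd
    have ih' := ih ⟨⟨Ne.symm h3f, fun h => (hdis f h).1 rfl, hff⟩, ⟨h3c, h3fs⟩, hcs, hfs,
      fun a ha b hb => (hdis a ha).2 b hb⟩ ⟨htf.1, htc.2.2.1, htc.2.2.2⟩ htf.2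
    intro g hg
    simp only [andCircuit, List.mem_append, List.mem_singleton] at hg
    rcases hg with (rfl | hg) | rfl
    · exact ⟨h12, h1f, h2f⟩
    · exact ih' g hg
    · exact ⟨h12, h1f, h2f⟩
  | case2 c₁ c₂ fs t =>
    simp only [List.cons_append, List.nodup_cons, List.mem_cons, not_or, List.mem_append] at hnd htc
    simpa [andCircuit, Gate.WellFormed] using ⟨hnd.1.1, Ne.symm htc.1, Ne.symm htc.2.1⟩
  | case3 fs cs t h1 h2 =>
    intro g hg
    rw [andCircuit] at hg
    · simp at hg
    · exact h1
    · exact h2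

theorem orCircuit_wellFormed (cs fs : List Q) (t : Q) (hnd : (cs ++ fs).Nodup) (htc : t ∉ cs)
    (htf : t ∉ fs) : ∀ g ∈ orCircuit cs fs t, g.WellFormed := by
  intro g hg
  simp only [orCircuit, List.mem_append, List.mem_map, List.mem_singleton] at hg
  rcases hg with ((⟨c, _, rfl⟩ | hg) | rfl) | ⟨c, _, rfl⟩
  · trivial
  · exact andCircuit_wellFormed cs fs t hnd htc htf g hg
  · trivial
  · trivial

theorem andCircuit_length_le (cs fs : List Q) (t : Q) :
    (andCircuit cs fs t).length ≤ 2 * cs.length := by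
  induction cs, fs, t using andCircuit.induct with
  | case1 c₁ c₂ c₃ cs f fs t ih =>
    simp only [andCircuit, List.length_append, List.length_cons, List.length_nil] at ih ⊢
    omega
  | case2 c₁ c₂ fs t => simp [andCircuit]
  | case3 fs cs t h1 h2 =>
    rw [andCircuit]
    · simp
    · exact h1
    · exact h2

theorem orCircuit_length_le (cs fs : List Q) (t : Q) :
    (orCircuit cs fs t).length ≤ 4 * cs.length + 1 := by
  have := andCircuit_length_le cs fs t
  simp only [orCircuit, List.length_append, List.length_cons, List.length_nil, List.length_map]
  omega

end

theorem length_flatMap_le {Q ι : Type} (l : List ι) (c : ι → Circuit Q) (b : ℕ)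
    (h : ∀ i ∈ l, (c i).length ≤ b) : (l.flatMap c).length ≤ l.length * b := by
  induction l with
  | nil => simp
  | cons i l ih =>
    have h1 := h i (by simp)
    have h2 := ih fun j hj => h j (by simp [hj])
    simp only [List.flatMap_cons, List.length_append, List.length_cons, Nat.succ_mul]
    omega

/-! ### The oracle -/

section Oracle

variable {n m : ℕ}

/-- The bit string of the register with the given values, and with `F(k) = 0`. -/
def regState (e : EdgeVec n) (r : Bool) (P : ℕ → Fin n → Bool) (A : Fin n → Bool)
    (T : Fin m → Bool) : Qubit n m → Bool
  | .inl a => e a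
  | .inr .R => r
  | .inr (.P d j) => P d j
  | .inr (.A k) => A k
  | .inr (.F _) => false
  | .inr (.T o) => T o

theorem registerBits_eq (e : EdgeVec n) (r : Bool) :
    registerBits m e r = regState e r (fun _ _ => false) (fun _ => false) (fun _ => false) := by
  funext q
  rcases q with a | (_ | ⟨d, j⟩ | k | k | o) <;> rfl

@[simp] theorem regState_qE (e : EdgeVec n) (r P A) (T : Fin m → Bool) (j k : Fin n) (h : j ≠ k) :
    regState e r P A T (qE j k h) = adj e j k := by
  simp [regState, qE, adj, h]

@[simp] theorem regState_qR (e : EdgeVec n) (r P A) (T : Fin m → Bool) :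
    regState e r P A T qR = r := rfl

@[simp] theorem regState_qP (e : EdgeVec n) (r P A) (T : Fin m → Bool) (d : Dist n) (j : Fin n) :
    regState e r P A T (qP d j) = P d j := rfl

@[simp] theorem regState_qA (e : EdgeVec n) (r P A) (T : Fin m → Bool) (k : Fin n) :
    regState e r P A T (qA k) = A k := rfl

@[simp] theorem regState_qF (e : EdgeVec n) (r P A) (T : Fin m → Bool) (k : Fin n) :
    regState e r P A T (qF k) = false := rfl

@[simp] theorem regState_qT (e : EdgeVec n) (r P A) (T : Fin m → Bool) (o : Fin m) :
    regState e r P A T (qT o) = T o := rfl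

theorem qA_injective : Function.Injective (qA : Fin n → Qubit n m) := by
  intro j k h
  simpa [qA] using h

theorem qF_injective : Function.Injective (qF : Fin n → Qubit n m) := by
  intro j k h
  simpa [qF] using h

theorem qT_injective : Function.Injective (qT : Fin m → Qubit n m) := by
  intro j k h
  simpa [qT] using h

theorem fList_nodup : (fList n m).Nodup := (List.nodup_finRange n).map qF_injective

theorem mem_fList {q : Qubit n m} : q ∈ fList n m ↔ ∃ k, qF k = q := by
  simp [fList]

theorem regState_fList (e : EdgeVec n) (r P A) (T : Fin m → Bool) :
    ∀ f ∈ fList n m, regState e r P A T f = false := by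
  intro f hf
  obtain ⟨k, rfl⟩ := mem_fList.mp hf
  rfl

theorem update_qP (e : EdgeVec n) (r P A) (T : Fin m → Bool) (d : Dist n) (j : Fin n) (b : Bool) :
    Function.update (regState e r P A T) (qP d j) b =
      regState e r (fun d₁ k => if d₁ = d ∧ k = j then b else P d₁ k) A T := by
  funext q
  rw [Function.update_apply]
  rcases q with a | (_ | ⟨d₁, i⟩ | i | i | i) <;> simp only [qP, regState, Sum.inr.injEq,
    reduceCtorEq, if_false, Work.P.injEq, Subtype.ext_iff]

theorem update_qT (e : EdgeVec n) (r P A) (T : Fin m → Bool) (o : Fin m) (b : Bool) :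
    Function.update (regState e r P A T) (qT o) b =
      regState e r P A (Function.update T o b) := by
  funext q
  rw [Function.update_apply]
  rcases q with a | (_ | ⟨d₁, i⟩ | i | i | i) <;> simp only [qT, regState, Sum.inr.injEq,
    reduceCtorEq, if_false, Work.T.injEq, Function.update_apply]

theorem update_qR (e : EdgeVec n) (r P A) (T : Fin m → Bool) (b : Bool) :
    Function.update (regState e r P A T) qR b = regState e b P A T := by
  funext q
  rw [Function.update_apply]
  rcases q with a | (_ | ⟨d₁, i⟩ | i | i | i) <;> simp only [qR, regState, Sum.inr.injEq,
    reduceCtorEq, if_false, if_true]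

/-- Block `k` writes only `A(k)` and reads only `P` and `E` qubits, which no block changes. -/
theorem neighbourCircuit_act (o : Fin n) (d' : Dist n) (j : Fin n) (e : EdgeVec n) (r : Bool)
    (P : ℕ → Fin n → Bool) (T : Fin m → Bool) :
    Circuit.act (neighbourCircuit o d' j) (regState e r P (fun _ => false) T) =
      regState e r P (fun k => decide (k ≠ j ∧ k ≠ o) && (P d' k && adj e k j)) T := by
  refine act_flatMap _ _ (fun q => match q with
    | .inr (.A k) => some k
    | _ => none) _ _ (List.nodup_finRange n) ?_ ?_
  · intro k _ y hy
    have hP : y (qP d' k) = P d' k := hy (qP d' k) (by simp [qP])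
    have hA : y (qA k) = false := hy (qA k) (by simp [qA])
    by_cases h : k ≠ j ∧ k ≠ o
    · have hE : y (qE k j h.1) = adj e k j := by
        rw [hy (qE k j h.1) (by simp [qE]), regState_qE]
      rw [dif_pos h, Circuit.act_cons, Circuit.act_nil,
        Gate.act_ccnot (by simp [qP, qE]) (by simp [qP, qA]) (by simp [qE, qA]), hP, hE, hA]
      funext q
      rcases q with a | (_ | ⟨d, i⟩ | i | i | i) <;> simp [qA, Function.update_apply]
      by_cases hi : i = k
      · subst hi; simp [regState, h]
      · simp [hi]
    · rw [dif_neg h, Circuit.act_nil]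
      funext q
      rcases q with a | (_ | ⟨d, i⟩ | i | i | i) <;> simp
      rintro rfl
      rw [show y (.inr (.A i)) = false from hA]
      by_cases h1 : i = j <;> by_cases h2 : i = o <;> simp_all [regState]
  · intro q hq
    rcases q with a | (_ | ⟨d, i⟩ | i | i | i) <;> simp at hq <;> rfl

theorem obs_injective (D : DistanceData n m) : Function.Injective (obs D) := (obs D).injective

/-- The controls of the OR in UPDATE. -/
theorem update_controls_nodup (o j : Fin n) (d' : Dist n) :
    ((((List.finRange n).filter fun k => k ≠ o ∧ k ≠ j).map qA ++ [qP d' j]) ++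
      fList n m).Nodup := by
  have h := fList_nodup (n := n) (m := m)
  rw [List.nodup_append, List.nodup_append]
  refine ⟨⟨((List.nodup_finRange n).filter _).map qA_injective, by simp, ?_⟩, h, ?_⟩
  · simp +contextual [qA, qP]
    grind
  · intro a ha b hb
    obtain ⟨k, rfl⟩ := mem_fList.mp hb
    rintro rfl
    simp [qA, qP, qF] at ha

/-- Block `j` owns the single qubit `P(d, j)`. It reads row `d'`, which stays fixed, and it leaves
the ancillae `A` clean for the next block. -/
theorem updateCircuit_act (hn : 4 ≤ n) (o : Fin n) (d' d : Dist n) (hd : d' ≠ d) (e : EdgeVec n)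
    (r : Bool) (P : ℕ → Fin n → Bool) (T : Fin m → Bool) (hP : ∀ j, P d j = false) :
    Circuit.act (updateCircuit o d' d) (regState e r P (fun _ => false) T) =
      regState e r (Function.update P d fun j => decide (j ≠ o) && (P d' j ||
        decide (∃ k, k ≠ o ∧ k ≠ j ∧ (P d' k && adj e k j) = true))) (fun _ => false) T := by
  have hd' : (d' : ℕ) ≠ d := fun h => hd (Subtype.ext h)
  refine act_flatMap _ _ (fun q => match q with
    | .inr (.P d₁ j) => if d₁ = d then some j else none
    | _ => none) _ _ ((List.nodup_finRange n).filter _) ?_ ?_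
  · intro j hj y hy
    have hjo : j ≠ o := by simpa using hj
    obtain ⟨P', hyP, hP', hPj⟩ : ∃ P' : ℕ → Fin n → Bool,
        y = regState e r P' (fun _ => false) T ∧ P' d' = P d' ∧ P' d j = false := by
      -- The state `y` determines rows only for indices in range; the values elsewhere are
      -- immaterial.
      refine ⟨fun d₁ k => if h : d₁ ∈ Finset.Icc 1 (n - 1) then y (qP ⟨d₁, h⟩ k) else P d₁ k,
        ?_, ?_, ?_⟩
      · funext q
        rcases q with a | (_ | ⟨d₁, i⟩ | i | i | i)
        · exact hy _ (by simp)
        · exact hy _ (by simp)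
        · have := d₁.2
          simp only [regState]
          rw [dif_pos this]
          rfl
        · exact hy _ (by simp)
        · exact hy _ (by simp)
        · exact hy _ (by simp)
      · funext k
        simp only [dif_pos d'.2]
        exact hy (qP d' k) (by simp [qP, hd])
      · simp only [dif_pos d.2]
        exact (hy (qP d j) (by simp +contextual [qP])).trans (hP j)
    -- An AND with one control would be the empty circuit, so besides `P(d', j)` some `A(k)` must be
    -- a control; this is where a third vertex is needed.
    have hctl : ((List.finRange n).filter fun k => k ≠ o ∧ k ≠ j) ≠ [] := by
      have : ∃ k : Fin n, k ≠ o ∧ k ≠ j := by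
        have h3 : ({o, j} : Finset (Fin n)).card < (Finset.univ : Finset (Fin n)).card := by
          have := Finset.card_le_two (a := o) (b := j)
          simp only [Finset.card_univ, Fintype.card_fin]
          omega
        obtain ⟨k, _, hk⟩ := Finset.exists_mem_notMem_of_card_lt_card h3
        exact ⟨k, by simpa using hk⟩
      obtain ⟨k, hk⟩ := this
      exact List.ne_nil_of_mem (a := k) (by simpa using hk)
    rw [Circuit.act_append, Circuit.act_append, hyP, neighbourCircuit_act, orCircuit_act]
    · have hany : (((List.finRange n).filter fun k => k ≠ o ∧ k ≠ j).map qA ++ [qP d' j]).any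
          (regState e r P' (fun k => decide (k ≠ j ∧ k ≠ o) && (P' d' k && adj e k j)) T) =
          (P d' j || decide (∃ k, k ≠ o ∧ k ≠ j ∧ (P d' k && adj e k j) = true)) := by
        rw [Bool.eq_iff_iff]
        simp only [List.any_append, List.any_map, List.any_cons, List.any_nil, hP', regState_qP,
          Bool.or_false, Bool.or_eq_true, List.any_eq_true, List.mem_filter, List.mem_finRange,
          decide_eq_true_eq, Function.comp_apply, regState_qA, Bool.and_eq_true, true_and]
        rw [or_comm]
        refine or_congr_right (exists_congr fun k => ?_)
        tauto
      set b := (P d' j || decide (∃ k, k ≠ o ∧ k ≠ j ∧ (P d' k && adj e k j) = true)) with hb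
      rw [hany, regState_qP, hPj, Bool.false_xor]
      rw [update_qP]
      -- The OR has changed only row `d ≠ d'`, so the same computation of the `A(k)` holds after it
      -- and can be reversed.
      have hrev := neighbourCircuit_act o d' j e r
        (fun d₁ k => if d₁ = d ∧ k = j then b else P' d₁ k) T
      simp only [hd', false_and, if_false] at hrev
      rw [Circuit.act_reverse_eq hrev]
      funext q
      rcases q with a | (_ | ⟨d₁, i⟩ | i | i | i) <;> simp [regState]
      by_cases h1 : d₁ = d <;> by_cases h2 : i = j
      · subst h1 h2
        simp [hb, hjo]
      · simp [h1, h2]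
      · simp [h1, h2]
      · simp [h1, h2]
    · have := List.length_pos_iff.mpr hctl
      rw [List.length_append, List.length_map]
      rw [List.length_singleton]
      omega
    · have := List.length_filter_le (fun k => decide (k ≠ o ∧ k ≠ j)) (List.finRange n)
      rw [List.length_finRange] at this
      simp only [List.length_append, List.length_map, fList, List.length_finRange,
        List.length_singleton]
      omega
    · exact update_controls_nodup o j d'
    · simp [qP, qA, Ne.symm hd]
    · simp [qP, qF, fList]
    · exact regState_fList _ _ _ _ _
  · intro q hq
    rcases q with a | (_ | ⟨d₁, i⟩ | i | i | i)
    · rfl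
    · rfl
    · simp only [regState, Function.update_apply]
      split_ifs with h
      · have h' : d₁ = d := Subtype.ext h
        subst h'
        simp only [ite_true, ne_eq, Option.some.injEq] at hq
        -- The loop skips `o`, so the only unowned qubit of row `d` is `P(d, o)`, which stays zero.
        have : i = o := by
          by_contra hi
          exact hq i (by simpa using hi) rfl
        simp [this, hP]
      · rfl
    · rfl
    · rfl
    · rfl

/-- The part of PATHS that computes `P(1, ·)`. -/
theorem firstRow_act (o : Fin n) (e : EdgeVec n) (r : Bool) (T : Fin m → Bool) :
    Circuit.act ((List.finRange n).flatMap fun j =>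
      if h : j ≠ o then [.cnot (qE j o h) (qP ⟨1, one_mem_dist h⟩ j)] else [])
      (regState e r (fun _ _ => false) (fun _ => false) T) =
      regState e r (fun d j => decide (d ≤ 1 ∧ j ≠ o) && pathTable e o d j)
        (fun _ => false) T := by
  refine act_flatMap _ _ (fun q => match q with
    | .inr (.P d j) => if (d : ℕ) = 1 then some j else none
    | _ => none) _ _ (List.nodup_finRange n) ?_ ?_
  · intro j _ y hy
    by_cases h : j ≠ o
    · have hE : y (qE j o h) = adj e j o := by
        rw [hy _ (by simp [qE]), regState_qE]
      have hP : y (qP ⟨1, one_mem_dist h⟩ j) = false := hy _ (by simp [qP])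
      rw [dif_pos h, Circuit.act_cons, Circuit.act_nil, Gate.act_cnot (by simp [qE, qP]), hP, hE,
        Bool.false_xor]
      funext q
      rw [Function.update_apply]
      rcases q with a | (_ | ⟨d, i⟩ | i | i | i) <;> simp [qP]
      by_cases hi : i = j
      · subst hi
        by_cases hd : (d : ℕ) = 1
        · simp [Subtype.ext_iff, hd, regState, h, pathTable, adj_comm e o]
        · simp [Subtype.ext_iff, hd]
      · simp [hi]
    · rw [dif_neg h, Circuit.act_nil]
      simp only [ne_eq, not_not] at h
      subst h
      funext q
      rcases q with a | (_ | ⟨d, i⟩ | i | i | i) <;> simp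
      intro hd hi
      subst hi
      rw [hy (.inr (.P d i)) (by simp)]
      simp [regState]
  · intro q hq
    rcases q with a | (_ | ⟨d, i⟩ | i | i | i)
    · rfl
    · rfl
    · have hd := (Finset.mem_Icc.mp d.2).1
      have : ¬ (d : ℕ) ≤ 1 := by
        intro h
        have : (d : ℕ) = 1 := by omega
        simp [this] at hq
      simp [regState, this]
    · rfl
    · rfl
    · rfl

/-- Invariant: after `k` updates the rows up to `k + 1` are filled and later rows are still zero, as
the next update requires. Column `o` stays zero even where `pathTable` is true there; this is
harmless since the recursion never reads `k = o`. -/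
theorem pathsCircuit_act (hn : 4 ≤ n) (o : Fin n) (e : EdgeVec n) (r : Bool) (T : Fin m → Bool) :
    Circuit.act (pathsCircuit o) (regState e r (fun _ _ => false) (fun _ => false) T) =
      regState e r (fun d j => decide (d ≤ n - 1 ∧ j ≠ o) && pathTable e o d j)
        (fun _ => false) T := by
  rw [pathsCircuit, Circuit.act_append, firstRow_act]
  have key := act_flatMap_finRange (n - 2) (fun i => updateCircuit (m := m) o
      ⟨i.val + 1, by have := i.isLt; simp only [Finset.mem_Icc]; omega⟩
      ⟨i.val + 2, by have := i.isLt; simp only [Finset.mem_Icc]; omega⟩)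
    (fun k => regState e r (fun d j => decide (d ≤ k + 1 ∧ j ≠ o) && pathTable e o d j)
        (fun _ => false) T) ?_
  · have h1 : n - 2 + 1 = n - 1 := by omega
    simp only [h1, zero_add] at key
    exact key
  · intro i
    rw [updateCircuit_act hn]
    · congr 1
      funext d j
      rw [Function.update_apply]
      by_cases hd : d = i.val + 2
      · subst hd
        simp only [if_true, pathTable, le_refl, true_and]
        by_cases hj : j = o
        · simp [hj]
        · simp only [ne_eq, hj, not_false_eq_true, decide_true, Bool.true_and]
          congr 1
          rw [decide_eq_decide]
          refine exists_congr fun k => ?_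
          by_cases hk : k = o <;> simp [hk]
      · have : d ≤ i.val + 1 ↔ d ≤ i.val + 1 + 1 := by omega
        simp [hd, this]
    · simp [Subtype.ext_iff]
    · intro j
      simp

/-- The flag computed from the ancillae `P(d, j)`. -/
def rowFlag (d : ℕ) (p : ℕ → Bool) : Bool :=
  if d = 1 then p 1 else p d && !p (d - 1)

/-- The circuit uses `d₀ j o` and the test `d₀ o j`, which agree by symmetry; positivity rules out
the value `0`, on which the two case distinctions differ. -/
theorem distanceFlag_eq (D : DistanceData n m) (e : EdgeVec n) (o j : Fin m) (h : j ≠ o) :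
    distanceFlag D e o j = rowFlag (D.d₀ j o) fun d => pathTable e (obs D o) d (obs D j) := by
  have h1 := D.one_le j o h
  unfold distanceFlag rowFlag
  rw [D.symm o j]
  by_cases hd : D.d₀ j o = 1
  · simp [hd]
  · have : 2 ≤ D.d₀ j o := by omega
    simp [hd, this, Bool.and_comm]

/-- The state of the ancillae `P(d, j)` after the computation of the flags. -/
def flagRows (D : DistanceData n m) (o : Fin m) (P : ℕ → Fin n → Bool) (d : ℕ) (k : Fin n) :
    Bool :=
  if h : k.val < m then
    xor (P d k) (decide ((⟨k, h⟩ : Fin m) ≠ o ∧ D.d₀ ⟨k, h⟩ o ≠ 1 ∧ d = D.d₀ ⟨k, h⟩ o - 1))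
  else P d k

/-- The flags `A(j)`. -/
def flags (D : DistanceData n m) (o : Fin m) (P : ℕ → Fin n → Bool) (k : Fin n) : Bool :=
  if h : k.val < m then
    decide ((⟨k, h⟩ : Fin m) ≠ o) && rowFlag (D.d₀ ⟨k, h⟩ o) fun d => P d k
  else false

theorem obs_val (D : DistanceData n m) (j : Fin m) : (obs D j).val = j.val := rfl

theorem eq_obs_iff (D : DistanceData n m) (k : Fin n) (j : Fin m) :
    k = obs D j ↔ ∃ h : k.val < m, (⟨k, h⟩ : Fin m) = j := by
  constructor
  · rintro rfl
    exact ⟨j.2, rfl⟩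
  · rintro ⟨h, rfl⟩
    rfl

/-- Block `j` owns column `j` of `P` together with `A(j)`. The NOT on `P(d-1, j)` is not undone
inside the block, hence the flipped entries in `flagRows`; the reversed circuit in TEST restores
them. -/
theorem flagCircuit_act (D : DistanceData n m) (o : Fin m) (e : EdgeVec n) (r : Bool)
    (P : ℕ → Fin n → Bool) (T : Fin m → Bool) :
    Circuit.act (flagCircuit D o) (regState e r P (fun _ => false) T) =
      regState e r (flagRows D o P) (flags D o P) T := by
  refine act_flatMap _ _ (fun q => match q with
    | .inr (.P _ k) => if h : k.val < m then some ⟨k, h⟩ else none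
    | .inr (.A k) => if h : k.val < m then some ⟨k, h⟩ else none
    | _ => none) _ _ (List.nodup_finRange m) ?_ ?_
  · intro j _ y hy
    have hP : ∀ d, y (qP d (obs D j)) = P d (obs D j) := fun d =>
      hy _ (by simp [qP, obs_val])
    have hA : y (qA (obs D j)) = false := hy _ (by simp [qA, obs_val])
    have hown : ∀ k : Fin n, ((if h : k.val < m then some (⟨k, h⟩ : Fin m) else none) = some j) ↔
        k = obs D j := by
      intro k
      rw [eq_obs_iff]
      by_cases hk : k.val < m <;> simp [hk]
    have hfr : ∀ d, flagRows D o P d (obs D j) =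
        xor (P d (obs D j)) (decide (j ≠ o ∧ D.d₀ j o ≠ 1 ∧ d = D.d₀ j o - 1)) := fun d =>
      dif_pos j.2
    have hfl : flags D o P (obs D j) = (decide (j ≠ o) && rowFlag (D.d₀ j o) fun d =>
        P d (obs D j)) := dif_pos j.2
    by_cases h : j ≠ o
    · by_cases h1 : D.d₀ j o = 1
      · rw [dif_pos h, dif_pos h1, Circuit.act_cons, Circuit.act_nil,
          Gate.act_cnot (by simp [qP, qA]), hP, hA]
        funext q
        rw [Function.update_apply]
        rcases q with a | (_ | ⟨d, i⟩ | i | i | i) <;> simp [qA, hown]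
        · rintro rfl
          simp only [regState, hfr]
          simpa [h1, qP] using hP d
        · by_cases hi : i = obs D j
          · subst hi
            simp [regState, hfl, h, h1, rowFlag]
          · simp [hi]
      · have h2 : D.d₀ j o - 1 ≠ D.d₀ j o := by have := D.one_le j o h; omega
        rw [dif_pos h, dif_neg h1, Circuit.act_cons, Circuit.act_cons, Circuit.act_nil,
          Gate.act_not, Gate.act_ccnot (by simp [qP, h2.symm]) (by simp [qP, qA])
          (by simp [qP, qA]), Function.update_of_ne (by simp [qP, qA]),
          Function.update_of_ne (by simp [qP, h2.symm]), Function.update_self, hP, hP, hA]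
        funext q
        rw [Function.update_apply, Function.update_apply]
        rcases q with a | (_ | ⟨d, i⟩ | i | i | i) <;> simp [qA, qP, hown]
        · by_cases hi : i = obs D j
          · subst hi
            have := hP d
            simp only [qP] at this
            by_cases hd : (d : ℕ) = D.d₀ j o - 1
            · simp [Subtype.ext_iff, hd, regState, hfr, h, h1]
            · simp [Subtype.ext_iff, hd, regState, hfr, this]
          · simp [hi]
        · by_cases hi : i = obs D j
          · subst hi
            simp [regState, hfl, h, h1, rowFlag]
          · simp [hi]
    · rw [dif_neg h, Circuit.act_nil]
      funext q
      rcases q with a | (_ | ⟨d, i⟩ | i | i | i) <;> simp [hown]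
      · rintro rfl
        simp only [regState, hfr]
        simpa [h, qP] using hP d
      · rintro rfl
        simp only [regState, hfl]
        simpa [h, qA] using hA
  · intro q hq
    rcases q with a | (_ | ⟨d, i⟩ | i | i | i)
    · rfl
    · rfl
    · by_cases hi : i.val < m
      · simp [hi] at hq
      · simp [regState, flagRows, hi]
    · by_cases hi : i.val < m
      · simp [hi] at hq
      · simp [regState, flags, hi]
    · rfl
    · rfl

theorem length_filter_ne (o : Fin m) : ((List.finRange m).filter (· ≠ o)).length = m - 1 := by
  rw [← List.toFinset_card_of_nodup ((List.nodup_finRange m).filter _)]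
  have : ((List.finRange m).filter (· ≠ o)).toFinset = Finset.univ.erase o := by
    ext j
    simp
  rw [this, Finset.card_erase_of_mem (Finset.mem_univ o), Finset.card_univ, Fintype.card_fin]

theorem test_controls_nodup (D : DistanceData n m) (o : Fin m) :
    ((((List.finRange m).filter (· ≠ o)).map fun j => (qA (obs D j) : Qubit n m)) ++
      fList n m).Nodup := by
  rw [List.nodup_append]
  refine ⟨((List.nodup_finRange m).filter _).map (qA_injective.comp (obs_injective D)),
    fList_nodup, ?_⟩
  intro a ha b hb
  obtain ⟨k, rfl⟩ := mem_fList.mp hb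
  rintro rfl
  simp [qA, qF] at ha

theorem oracle_controls_nodup : ((List.finRange m).map (qT : Fin m → Qubit n m) ++
    fList n m).Nodup := by
  rw [List.nodup_append]
  refine ⟨(List.nodup_finRange m).map qT_injective, fList_nodup, ?_⟩
  intro a ha b hb
  obtain ⟨k, rfl⟩ := mem_fList.mp hb
  rintro rfl
  simp [qT, qF] at ha

/-- The bit `t(o)` of the classical test. -/
def nodeTest (D : DistanceData n m) (e : EdgeVec n) (o : Fin m) : Bool :=
  decide (∀ j : Fin m, j ≠ o → distanceFlag D e o j = true)

/-- Compute, copy, uncompute: the actions of PATHS and of the flags are known for every content of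
the `T` qubits, so they can be reversed after `T(o)` has been written. -/
theorem testCircuit_act (D : DistanceData n m) (e : EdgeVec n) (r : Bool) :
    Circuit.act (testCircuit D) (regState e r (fun _ _ => false) (fun _ => false) fun _ => false) =
      regState e r (fun _ _ => false) (fun _ => false) (nodeTest D e) := by
  have hm := D.four_le
  have hmn := D.m_le_n
  refine act_flatMap _ _ (fun q => match q with
    | .inr (.T o) => some o
    | _ => none) _ _ (List.nodup_finRange m) ?_ ?_
  · intro o _ y hy
    have hyT : y = regState e r (fun _ _ => false) (fun _ => false) fun o => y (qT o) := by
      funext q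
      rcases q with a | (_ | ⟨d, i⟩ | i | i | i)
      · exact hy _ (by simp)
      · exact hy _ (by simp)
      · exact hy _ (by simp)
      · exact hy _ (by simp)
      · exact hy _ (by simp)
      · rfl
    have hTo : y (qT o) = false := hy _ (by simp [qT])
    generalize (fun o => y (qT o)) = T at hyT
    subst hyT
    simp only [regState_qT] at hTo
    set p : ℕ → Fin n → Bool := fun d j =>
      decide (d ≤ n - 1 ∧ j ≠ obs D o) && pathTable e (obs D o) d j with hp
    have hall : ((((List.finRange m).filter (· ≠ o)).map fun j => (qA (obs D j) : Qubit n m)).all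
        (regState e r (flagRows D o p) (flags D o p) T)) = nodeTest D e o := by
      rw [Bool.eq_iff_iff]
      simp only [List.all_map, List.all_eq_true, List.mem_filter, List.mem_finRange, true_and,
        decide_eq_true_eq, Function.comp_apply, regState_qA, nodeTest]
      refine forall₂_congr fun j hj => ?_
      rw [distanceFlag_eq D e o j hj]
      -- The quantum table stops at row `n - 1`; since `d₀ ≤ n - 1`, no later row is consulted.
      have hd := D.le_pred j o
      have hj' : obs D j ≠ obs D o := fun h => hj (obs_injective D h)
      have h1 : 1 ≤ n - 1 := by omega
      have h2 : D.d₀ j o - 1 ≤ n - 1 := by omega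
      simp [flags, obs_val, hj, hp, rowFlag, hd, hj', h1, h2]
    rw [Circuit.act_append, Circuit.act_append, Circuit.act_append, Circuit.act_append,
      pathsCircuit_act (by omega), flagCircuit_act, andCircuit_act, hall, regState_qT, hTo,
      Bool.false_xor, update_qT, Circuit.act_reverse_eq (flagCircuit_act D o e r p _),
      Circuit.act_reverse_eq (pathsCircuit_act (by omega) (obs D o) e r _)]
    · funext q
      rcases q with a | (_ | ⟨d, i⟩ | i | i | i) <;> simp [regState, Function.update_apply]
      split_ifs with h
      · rw [h]
      · rfl
    · rw [List.length_map, length_filter_ne]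
      omega
    · rw [List.length_map, length_filter_ne, fList, List.length_map, List.length_finRange]
      omega
    · exact test_controls_nodup D o
    · simp [qT, qA]
    · simp [qT, qF, fList]
    · exact regState_fList _ _ _ _ _
  · intro q hq
    rcases q with a | (_ | ⟨d, i⟩ | i | i | i)
    · rfl
    · rfl
    · rfl
    · rfl
    · rfl
    · simp at hq

/-- ORACLE is an oracle for the set accepted by the classical test. -/
theorem oracleCircuit_act (D : DistanceData n m) (e : EdgeVec n) (r : Bool) :
    Circuit.act (oracleCircuit D) (registerBits m e r) =
      registerBits m e (xor r (classicalTest D e)) := by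
  have hm := D.four_le
  have hmn := D.m_le_n
  have hall : ((List.finRange m).map (qT : Fin m → Qubit n m)).all
      (regState e r (fun _ _ => false) (fun _ => false) (nodeTest D e)) = classicalTest D e := by
    rw [Bool.eq_iff_iff]
    simp [List.all_map, List.all_eq_true, classicalTest, nodeTest]
  rw [registerBits_eq, oracleCircuit, Circuit.act_append, Circuit.act_append, testCircuit_act,
    andCircuit_act, hall, regState_qR, update_qR, registerBits_eq,
    Circuit.act_reverse_eq (testCircuit_act D e _)]
  · rw [List.length_map, List.length_finRange]
    omega
  · rw [List.length_map, List.length_finRange, fList, List.length_map, List.length_finRange]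
    omega
  · exact oracle_controls_nodup
  · simp [qR, qT]
  · simp [qR, qF, fList]
  · exact regState_fList _ _ _ _ _

/-! ### Well-formedness and resources of the oracle -/

theorem neighbourCircuit_wellFormed (o : Fin n) (d' : Dist n) (j : Fin n) :
    ∀ g ∈ neighbourCircuit (m := m) o d' j, g.WellFormed := by
  intro g hg
  simp only [neighbourCircuit, List.mem_flatMap] at hg
  obtain ⟨k, _, hg⟩ := hg
  split_ifs at hg with h
  · simp only [List.mem_singleton] at hg
    subst hg
    simp [Gate.WellFormed, qP, qE, qA]
  · simp at hg

theorem updateCircuit_wellFormed (o : Fin n) (d' d : Dist n) (hd : d' ≠ d) :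
    ∀ g ∈ updateCircuit (m := m) o d' d, g.WellFormed := by
  intro g hg
  simp only [updateCircuit, List.mem_flatMap] at hg
  obtain ⟨j, _, hg⟩ := hg
  simp only [List.mem_append, List.mem_reverse] at hg
  rcases hg with (hg | hg) | hg
  · exact neighbourCircuit_wellFormed o d' j g hg
  · refine orCircuit_wellFormed _ _ _ (update_controls_nodup o j d') ?_ ?_ g hg
    · simp [qP, qA, Ne.symm hd]
    · simp [qP, qF, fList]
  · exact neighbourCircuit_wellFormed o d' j g hg

theorem pathsCircuit_wellFormed (o : Fin n) : ∀ g ∈ pathsCircuit (m := m) o, g.WellFormed := by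
  intro g hg
  simp only [pathsCircuit, List.mem_append, List.mem_flatMap] at hg
  rcases hg with ⟨j, _, hg⟩ | ⟨i, _, hg⟩
  · split_ifs at hg with h
    · simp only [List.mem_singleton] at hg
      subst hg
      simp [Gate.WellFormed, qE, qP]
    · simp at hg
  · exact updateCircuit_wellFormed o _ _ (by simp [Subtype.ext_iff]) g hg

theorem flagCircuit_wellFormed (D : DistanceData n m) (o : Fin m) :
    ∀ g ∈ flagCircuit D o, g.WellFormed := by
  intro g hg
  simp only [flagCircuit, List.mem_flatMap] at hg
  obtain ⟨j, _, hg⟩ := hg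
  split_ifs at hg with h h1
  · simp only [List.mem_singleton] at hg
    subst hg
    simp [Gate.WellFormed, qP, qA]
  · have h2 : D.d₀ j o ≠ D.d₀ j o - 1 := by have := D.one_le j o h; omega
    simp only [List.mem_cons, List.not_mem_nil, or_false] at hg
    rcases hg with rfl | rfl
    · trivial
    · simp [Gate.WellFormed, qP, qA, h2]
  · simp at hg

theorem testCircuit_wellFormed (D : DistanceData n m) : ∀ g ∈ testCircuit D, g.WellFormed := by
  intro g hg
  simp only [testCircuit, List.mem_flatMap, List.mem_append, List.mem_reverse] at hg
  obtain ⟨o, _, (((hg | hg) | hg) | hg) | hg⟩ := hg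
  · exact pathsCircuit_wellFormed _ g hg
  · exact flagCircuit_wellFormed D o g hg
  · refine andCircuit_wellFormed _ _ _ (test_controls_nodup D o) ?_ ?_ g hg
    · simp [qT, qA]
    · simp [qT, qF, fList]
  · exact flagCircuit_wellFormed D o g hg
  · exact pathsCircuit_wellFormed _ g hg

theorem oracleCircuit_wellFormed (D : DistanceData n m) :
    ∀ g ∈ oracleCircuit D, g.WellFormed := by
  intro g hg
  simp only [oracleCircuit, List.mem_append, List.mem_reverse] at hg
  rcases hg with (hg | hg) | hg
  · exact testCircuit_wellFormed D g hg
  · refine andCircuit_wellFormed _ _ _ oracle_controls_nodup ?_ ?_ g hg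
    · simp [qR, qT]
    · simp [qR, qF, fList]
  · exact testCircuit_wellFormed D g hg

theorem neighbourCircuit_length_le (o : Fin n) (d' : Dist n) (j : Fin n) :
    (neighbourCircuit (m := m) o d' j).length ≤ n := by
  refine (length_flatMap_le _ _ 1 ?_).trans (by simp)
  intro k _
  split_ifs <;> simp

theorem updateCircuit_length_le (o : Fin n) (d' d : Dist n) :
    (updateCircuit (m := m) o d' d).length ≤ n * (6 * n + 5) := by
  have hfl := List.length_filter_le (fun k => decide (k ≠ o)) (List.finRange n)
  rw [List.length_finRange] at hfl
  refine (length_flatMap_le _ _ (6 * n + 5) ?_).trans (Nat.mul_le_mul_right _ hfl)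
  intro j _
  have h1 := neighbourCircuit_length_le (m := m) o d' j
  have h2 := orCircuit_length_le
    (((List.finRange n).filter fun k => k ≠ o ∧ k ≠ j).map qA ++ [(qP d' j : Qubit n m)])
    (fList n m) (qP d j)
  have h3 := List.length_filter_le (fun k => decide (k ≠ o ∧ k ≠ j)) (List.finRange n)
  rw [List.length_append, List.length_map, List.length_singleton] at h2
  rw [List.length_finRange] at h3
  simp only [List.length_append, List.length_reverse]
  omega

theorem pathsCircuit_length_le (o : Fin n) :
    (pathsCircuit (m := m) o).length ≤ n + n * (n * (6 * n + 5)) := by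
  rw [pathsCircuit, List.length_append]
  refine Nat.add_le_add ?_ ?_
  · refine (length_flatMap_le _ _ 1 ?_).trans (by simp)
    intro k _
    split_ifs <;> simp
  · refine (length_flatMap_le _ _ _ fun i _ => updateCircuit_length_le o _ _).trans ?_
    rw [List.length_finRange]
    exact Nat.mul_le_mul_right _ (Nat.sub_le _ _)

theorem flagCircuit_length_le (D : DistanceData n m) (o : Fin m) :
    (flagCircuit D o).length ≤ m * 2 := by
  refine (length_flatMap_le _ _ 2 ?_).trans (by simp)
  intro k _
  split_ifs <;> simp

theorem testCircuit_length_le (D : DistanceData n m) :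
    (testCircuit D).length ≤ m * (2 * (n + n * (n * (6 * n + 5))) + 6 * m) := by
  refine (length_flatMap_le _ _ (2 * (n + n * (n * (6 * n + 5))) + 6 * m) ?_).trans (by simp)
  intro o _
  have h1 := pathsCircuit_length_le (m := m) (obs D o)
  have h2 := flagCircuit_length_le D o
  have h3 := andCircuit_length_le
    (((List.finRange m).filter (· ≠ o)).map fun j => (qA (obs D j) : Qubit n m)) (fList n m) (qT o)
  rw [List.length_map, length_filter_ne] at h3
  simp only [List.length_append, List.length_reverse]
  omega

theorem oracleCircuit_length_le (D : DistanceData n m) :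
    (oracleCircuit D).length ≤ 100 * m * n ^ 3 := by
  have hm := D.four_le
  have hmn := D.m_le_n
  have h1 := testCircuit_length_le D
  have h2 := andCircuit_length_le ((List.finRange m).map (qT : Fin m → Qubit n m)) (fList n m) qR
  rw [List.length_map, List.length_finRange] at h2
  have h3 : (oracleCircuit D).length ≤
      m * (2 * (2 * (n + n * (n * (6 * n + 5))) + 6 * m) + 2) := by
    simp only [oracleCircuit, List.length_append, List.length_reverse]
    nlinarith
  refine h3.trans ?_
  rw [mul_comm 100 m, mul_assoc]
  refine Nat.mul_le_mul_left m ?_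
  -- With every lower power bounded by `n ^ 3` the coefficients add up to `4 + 24 + 20 + 12 + 2 =
  -- 62`, below `100`.
  have h4 : n ≤ n ^ 3 := Nat.le_self_pow (by norm_num) n
  have h5 : n ^ 2 ≤ n ^ 3 := Nat.pow_le_pow_right (by omega) (by norm_num)
  have h6 : 1 ≤ n ^ 3 := Nat.one_le_pow _ _ (by omega)
  have h7 : n * (n * (6 * n + 5)) = 6 * n ^ 3 + 5 * n ^ 2 := by ring
  rw [h7]
  omega

/-- The ancillae and the target, as a sum type. -/
def workEquiv (n m : ℕ) : Work n m ≃ Unit ⊕ (Dist n × Fin n) ⊕ Fin n ⊕ Fin n ⊕ Fin m where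
  toFun
    | .R => .inl ()
    | .P d j => .inr (.inl (d, j))
    | .A k => .inr (.inr (.inl k))
    | .F k => .inr (.inr (.inr (.inl k)))
    | .T o => .inr (.inr (.inr (.inr o)))
  invFun
    | .inl _ => .R
    | .inr (.inl (d, j)) => .P d j
    | .inr (.inr (.inl k)) => .A k
    | .inr (.inr (.inr (.inl k))) => .F k
    | .inr (.inr (.inr (.inr o))) => .T o
  left_inv q := by cases q <;> rfl
  right_inv q := by rcases q with _ | ⟨_, _⟩ | _ | _ | _ <;> rfl

theorem card_work : Fintype.card (Work n m) = 1 + ((n - 1) * n + (n + (n + m))) := by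
  rw [Fintype.card_congr (workEquiv n m)]
  simp

theorem card_edge : Fintype.card (Edge n) = edgeCount n := by
  have h : Fintype.card (Edge n) = ∑ j : Fin n, ((j : ℕ)) := by
    rw [Fintype.card_subtype, Finset.card_filter, Fintype.sum_prod_type_right]
    refine Finset.sum_congr rfl fun k _ => ?_
    rw [← Finset.card_filter]
    rw [← Fin.card_Iio k]
    congr 1
    ext x
    simp
  rw [h, Fin.sum_univ_eq_sum_range (fun i => i), Finset.sum_range_id, edgeCount]

theorem two_mul_edgeCount (n : ℕ) : 2 * edgeCount n = n * (n - 1) :=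
  Nat.mul_div_cancel' (Nat.even_mul_pred_self n).two_dvd

/-- The qubits `E` and `P` number `3N` with `N = edgeCount n`; the other `1 + 2n + m` fit into
another `3N` because `n ≥ 4`. -/
theorem card_qubit_le (D : DistanceData n m) :
    Fintype.card (Qubit n m) ≤ 6 * edgeCount n ∧ Fintype.card (Qubit n m) ≤ 6 * n ^ 2 := by
  have hm := D.four_le
  have hmn := D.m_le_n
  have h2 := two_mul_edgeCount n
  rw [Fintype.card_sum, card_work, card_edge]
  obtain ⟨k, rfl⟩ : ∃ k, n = k + 1 := ⟨n - 1, by omega⟩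
  simp only [Nat.add_sub_cancel] at h2 ⊢
  constructor <;> nlinarith

end Oracle

/-! ### Distances in graphs -/

section Graphs

variable {V W : Type} {G : SimpleGraph V} {H : SimpleGraph W}

theorem edist_iso (f : G ≃g H) (x y : V) : H.edist (f x) (f y) = G.edist x y := by
  have key : ∀ {V W : Type} {G : SimpleGraph V} {H : SimpleGraph W} (f : G →g H) (x y : V),
      H.edist (f x) (f y) ≤ G.edist x y := by
    intro V W G H f x y
    by_cases h : G.edist x y = ⊤
    · rw [h]; exact le_top
    · obtain ⟨p, hp⟩ := G.exists_walk_of_edist_ne_top h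
      rw [← hp, ← SimpleGraph.Walk.length_map f]
      exact SimpleGraph.edist_le _
  refine le_antisymm (key f.toHom x y) ?_
  have := key f.symm.toHom (f x) (f y)
  simpa using this

theorem exists_adj_of_edist_eq_succ {x b : V} {k : ℕ} (h : G.edist x b = (k : ℕ∞) + 1) :
    ∃ y, G.Adj x y ∧ G.edist y b = k := by
  obtain ⟨p, hp⟩ := G.exists_walk_of_edist_eq_coe (k := k + 1) (by rw [h]; push_cast; rfl)
  cases p with
  | nil => simp at hp
  | @cons _ y _ hxy q =>
    refine ⟨y, hxy, le_antisymm ?_ ?_⟩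
    · have := G.edist_le q
      rw [SimpleGraph.Walk.length_cons] at hp
      rwa [show q.length = k by omega] at this
    · have h1 := G.edist_triangle (u := x) (v := y) (w := b)
      rw [h, SimpleGraph.edist_eq_one_iff_adj.mpr hxy, add_comm] at h1
      exact (ENat.add_le_add_iff_left (by simp)).mp h1

theorem edist_le_edist_add_one {x y : V} (b : V) (h : G.Adj x y) :
    G.edist x b ≤ G.edist y b + 1 := by
  have h1 := G.edist_triangle (u := x) (v := y) (w := b)
  rwa [SimpleGraph.edist_eq_one_iff_adj.mpr h, add_comm] at h1

/-- A function with the local properties of the distance from `b` is the distance from `b`. -/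
theorem edist_eq_of_local {b : V} {φ : V → ℕ∞} (h0 : φ b = 0) (hz : ∀ x, φ x = 0 → x = b)
    (hlip : ∀ x y, G.Adj x y → φ x ≤ φ y + 1)
    (hpred : ∀ x (k : ℕ), φ x = (k : ℕ∞) + 1 → ∃ y, G.Adj x y ∧ φ y = k) (x : V) :
    G.edist x b = φ x := by
  apply le_antisymm
  · by_cases h : φ x = ⊤
    · rw [h]; exact le_top
    · obtain ⟨k, hk⟩ := ENat.ne_top_iff_exists.mp h
      clear h
      -- Following predecessors lowers `φ` by one at a time, down to the value zero, which is taken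
      -- only at `b`.
      induction k generalizing x with
      | zero =>
        rw [hz x (by rw [← hk]; rfl), SimpleGraph.edist_self]
        exact bot_le
      | succ k ih =>
        obtain ⟨y, hxy, hy⟩ := hpred x k (by rw [← hk]; push_cast; rfl)
        refine (edist_le_edist_add_one b hxy).trans ?_
        rw [← hk]
        push_cast
        gcongr
        rw [hy.symm]
        exact ih y hy.symm
  -- The one-step inequality telescopes along walks, so no walk to `b` is shorter than `φ`.
  · have hw : ∀ {x y : V} (p : G.Walk x y), φ x ≤ (p.length : ℕ∞) + φ y := by
      intro x y p
      induction p with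
      | nil => simp
      | cons h q ih =>
        refine (hlip _ _ h).trans ?_
        rw [SimpleGraph.Walk.length_cons]
        push_cast
        rw [add_assoc, add_comm 1, ← add_assoc]
        gcongr
    by_cases h : G.edist x b = ⊤
    · rw [h]; exact le_top
    · obtain ⟨p, hp⟩ := G.exists_walk_of_edist_ne_top h
      rw [← hp]
      simpa [h0] using hw p

end Graphs

/-! ### The classical test -/

section Test

variable {n m : ℕ}

/-- Breadth-first search: a vertex at distance exactly `d + 2` has a neighbour at distance `d + 1`.
Skipping `k = o` loses nothing, since that neighbour has positive distance. -/
theorem pathTable_eq_true_iff (e : EdgeVec n) (o : Fin n) (d : ℕ) (j : Fin n) (hj : j ≠ o) :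
    pathTable e o (d + 1) j = true ↔ (toGraph e).edist j o ≤ (d : ℕ∞) + 1 := by
  induction d generalizing j with
  | zero =>
    have h : pathTable e o (0 + 1) j = true ↔ (toGraph e).Adj j o := by
      simp only [pathTable]
      rw [adj_comm]
      rfl
    rw [h, Nat.cast_zero, zero_add, SimpleGraph.edist_le_one_iff_adj_or_eq]
    simp [hj]
  | succ d ih =>
    have h : pathTable e o (d + 1 + 1) j = true ↔ pathTable e o (d + 1) j = true ∨
        ∃ k, k ≠ o ∧ k ≠ j ∧ pathTable e o (d + 1) k = true ∧ (toGraph e).Adj k j := by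
      simp only [pathTable, Bool.or_eq_true, decide_eq_true_eq, Bool.and_eq_true]
      rfl
    rw [h, ih j hj]
    constructor
    · rintro (h | ⟨k, hko, _, hk, hkj⟩)
      · refine h.trans ?_
        push_cast
        exact le_self_add
      · refine (edist_le_edist_add_one o hkj.symm).trans ?_
        push_cast
        gcongr
        exact (ih k hko).mp hk
    · intro h
      by_cases h' : (toGraph e).edist j o ≤ (d : ℕ∞) + 1
      · exact Or.inl h'
      · right
        have heq : (toGraph e).edist j o = ((d + 1 : ℕ) : ℕ∞) + 1 := by
          refine le_antisymm h ?_
          push_cast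
          exact Order.add_one_le_of_lt (not_le.mp h')
        obtain ⟨k, hjk, hk⟩ := exists_adj_of_edist_eq_succ heq
        have hko : k ≠ o := by
          rintro rfl
          rw [SimpleGraph.edist_self] at hk
          exact absurd hk.symm (by simp)
        refine ⟨k, hko, hjk.ne', (ih k hko).mpr ?_, hjk.symm⟩
        rw [hk]
        push_cast
        exact le_refl _

/-- A distance is exactly `d` when it is at most `d` and not at most `d - 1`; for `d = 1` the second
condition is `j ≠ o`. -/
theorem distanceFlag_eq_true_iff (D : DistanceData n m) (e : EdgeVec n) (o j : Fin m)
    (h : j ≠ o) : distanceFlag D e o j = true ↔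
      (toGraph e).edist (obs D j) (obs D o) = (D.d₀ j o : ℕ∞) := by
  have hne : obs D j ≠ obs D o := fun h' => h (obs_injective D h')
  have h1 := D.one_le j o h
  have hp := pathTable_eq_true_iff e (obs D o)
  rw [distanceFlag_eq D e o j h, rowFlag]
  split_ifs with hd
  · rw [hd]
    have := hp 0 (obs D j) hne
    rw [zero_add, Nat.cast_zero, zero_add] at this
    rw [this, Nat.cast_one, SimpleGraph.edist_le_one_iff_adj_or_eq,
      SimpleGraph.edist_eq_one_iff_adj]
    simp [hne]
  · obtain ⟨d, hd'⟩ : ∃ d, D.d₀ j o = d + 1 + 1 := ⟨D.d₀ j o - 2, by omega⟩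
    rw [hd', Nat.add_sub_cancel, Bool.and_eq_true, Bool.not_eq_true', ← Bool.not_eq_true,
      hp _ _ hne, hp _ _ hne, not_le]
    push_cast
    constructor
    · rintro ⟨h2, h3⟩
      exact le_antisymm h2 (Order.add_one_le_of_lt h3)
    · intro h2
      refine ⟨h2.le, ?_⟩
      rw [h2]
      exact_mod_cast Nat.lt_succ_self _

theorem classicalTest_eq_true_iff (D : DistanceData n m) (e : EdgeVec n) :
    classicalTest D e = true ↔ IsSolution D e := by
  simp only [classicalTest, decide_eq_true_eq, IsSolution, Solves, Fintype.card_fin, true_and]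
  constructor
  · intro h i j
    by_cases hij : i = j
    · subst hij
      rw [SimpleGraph.edist_self, D.self_eq]
      rfl
    · exact (distanceFlag_eq_true_iff D e j i hij).mp (h j i hij)
  · intro h o j hjo
    exact (distanceFlag_eq_true_iff D e o j hjo).mpr (h j o)

theorem solutionBit_eq (D : DistanceData n m) (e : EdgeVec n) :
    solutionBit D e = classicalTest D e := by
  rw [Bool.eq_iff_iff, classicalTest_eq_true_iff]
  simp [solutionBit]

end Test

/-! ### The number of solutions -/

section Count

/-- If `u` and `v` have the same distances from the nodes `b i`, then `v` can be moved to a new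
place (its neighbours become neighbours of `u`) without changing the other distances. -/
theorem exists_graph_separating {V ι : Type} [Fintype V] (G : SimpleGraph V) (b : ι → V)
    (i₀ : ι) {u v : V} (huv : u ≠ v) (hv : ∀ i, b i ≠ v)
    (h : ∀ i, G.edist u (b i) = G.edist v (b i)) :
    ∃ G' : SimpleGraph V, (∀ x ≠ v, ∀ i, G'.edist x (b i) = G.edist x (b i)) ∧
      ∀ x ≠ v, G'.edist v (b i₀) ≠ G.edist x (b i₀) := by
  classical
  -- `w` is a vertex other than `v` farthest from `b i₀` at finite distance; a leaf hung on it is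
  -- farther still.
  obtain ⟨w, hw, hmax⟩ := Finset.exists_max_image
    (Finset.univ.filter fun x => x ≠ v ∧ G.edist x (b i₀) ≠ ⊤) (fun x => G.edist x (b i₀))
    ⟨b i₀, by simp [hv]⟩
  simp only [Finset.mem_filter, Finset.mem_univ, true_and] at hw hmax
  -- The edges of `v` are handed over to `u`, and `v` becomes a leaf at `w`. The function `φ` is the
  -- expected distance, verified with `edist_eq_of_local`.
  let r : V → V → Prop := fun x y =>
    (x ≠ v ∧ y ≠ v ∧ (G.Adj x y ∨ (x = u ∧ G.Adj v y))) ∨ (x = v ∧ y = w)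
  let φ : ι → V → ℕ∞ := fun i x => if x = v then G.edist w (b i) + 1 else G.edist x (b i)
  have hφ : ∀ i x, (SimpleGraph.fromRel r).edist x (b i) = φ i x := by
    intro i
    have hr : ∀ x y, r x y → φ i x ≤ φ i y + 1 ∧ φ i y ≤ φ i x + 1 := by
      rintro x y (⟨hx, hy, hxy | ⟨rfl, hxy⟩⟩ | ⟨rfl, rfl⟩)
      · simp only [φ, hx, hy, if_false]
        exact ⟨edist_le_edist_add_one _ hxy, edist_le_edist_add_one _ hxy.symm⟩
      · simp only [φ, hx, hy, if_false, h]
        exact ⟨edist_le_edist_add_one _ hxy, edist_le_edist_add_one _ hxy.symm⟩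
      · simp only [φ, hw.1, if_false, if_true]
        exact ⟨le_refl _, le_self_add.trans le_self_add⟩
    refine edist_eq_of_local ?_ ?_ ?_ ?_
    · simp [φ, hv]
    · intro x hx
      by_cases hxv : x = v
      · simp [φ, hxv] at hx
      · simpa [φ, hxv] using hx
    · intro x y hxy
      rw [SimpleGraph.fromRel_adj] at hxy
      rcases hxy.2 with h' | h'
      · exact (hr x y h').1
      · exact (hr y x h').2
    · intro x k hx
      by_cases hxv : x = v
      · subst hxv
        simp only [φ, if_true] at hx
        refine ⟨w, ?_, ?_⟩
        · rw [SimpleGraph.fromRel_adj]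
          exact ⟨Ne.symm hw.1, Or.inl (Or.inr ⟨rfl, rfl⟩)⟩
        · simp only [φ, hw.1, if_false]
          exact le_antisymm ((ENat.add_le_add_iff_right (by simp)).mp hx.le)
            ((ENat.add_le_add_iff_right (by simp)).mp hx.ge)
      · simp only [φ, hxv, if_false] at hx
        obtain ⟨y, hxy, hy⟩ := exists_adj_of_edist_eq_succ hx
        by_cases hyv : y = v
        -- A shortest path through `v` is rerouted through `u`, which has the same distances. The
        -- case `x = u` cannot occur, because `x` is one step farther from `b i` than `v`.
        · subst hyv
          refine ⟨u, ?_, by simp [φ, huv, h, hy]⟩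
          rw [SimpleGraph.fromRel_adj]
          refine ⟨?_, Or.inr (Or.inl ⟨huv, hxv, Or.inr ⟨rfl, hxy.symm⟩⟩)⟩
          rintro rfl
          rw [h, hy] at hx
          exact absurd hx (by exact_mod_cast (Nat.lt_succ_self k).ne)
        · refine ⟨y, ?_, by simp [φ, hyv, hy]⟩
          rw [SimpleGraph.fromRel_adj]
          exact ⟨hxy.ne, Or.inl (Or.inl ⟨hxv, hyv, Or.inl hxy⟩)⟩
  refine ⟨SimpleGraph.fromRel r, ?_, ?_⟩
  · intro x hx i
    simp [hφ, φ, hx]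
  · intro x hx heq
    simp only [hφ, φ, if_true] at heq
    have hfin : G.edist x (b i₀) ≠ ⊤ := by
      rw [← heq]
      simpa using hw.2
    have h1 := hmax x ⟨hx, hfin⟩
    rw [← heq] at h1
    exact absurd h1 (not_le.mpr (ENat.lt_add_one_iff hw.2 |>.mpr le_rfl))

/-- There is a graph with the same distances between
them in which different vertices have different distances from the nodes. -/
theorem exists_graph_injective {V ι : Type} [Fintype V] (G : SimpleGraph V) (b : ι → V)
    (i₀ : ι) (d : ι → ι → ℕ∞) (hG : ∀ i j, G.edist (b i) (b j) = d i j) :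
    ∃ G' : SimpleGraph V, (∀ i j, G'.edist (b i) (b j) = d i j) ∧
      Function.Injective fun x i => G'.edist x (b i) := by
  classical
  let φ : SimpleGraph V → V → ι → ℕ∞ := fun G x i => G.edist x (b i)
  -- Extremal choice: a graph with these distances that realises the largest number of distance
  -- profiles.
  obtain ⟨G', hG', hmax⟩ := Set.exists_max_image
    {G : SimpleGraph V | ∀ i j, G.edist (b i) (b j) = d i j}
    (fun G => (Finset.univ.image (φ G)).card) (Set.toFinite _) ⟨G, hG⟩
  refine ⟨G', hG', ?_⟩
  by_contra hinj
  -- A node shares its profile with no other vertex, since only it has distance zero from itself; so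
  -- `v` may be moved.
  have hsep : ∃ u v, u ≠ v ∧ (∀ i, b i ≠ v) ∧ φ G' u = φ G' v := by
    simp only [Function.Injective, not_forall] at hinj
    obtain ⟨u, v, huv, hne⟩ := hinj
    by_cases hv : ∀ i, b i ≠ v
    · exact ⟨u, v, hne, hv, huv⟩
    · push Not at hv
      obtain ⟨i, rfl⟩ := hv
      have := congrFun huv i
      simp only [SimpleGraph.edist_self, SimpleGraph.edist_eq_zero_iff] at this
      exact absurd this hne
  obtain ⟨u, v, hne, hv, huv⟩ := hsep
  obtain ⟨G'', h1, h2⟩ := exists_graph_separating G' b i₀ hne hv (congrFun huv)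
  have hsol : ∀ i j, G''.edist (b i) (b j) = d i j := fun i j => by rw [h1 _ (hv i), hG']
  have hle := hmax G'' hsol
  have hsub : insert (φ G'' v) (Finset.univ.image (φ G')) ⊆ Finset.univ.image (φ G'') := by
    intro a ha
    rw [Finset.mem_insert] at ha
    rcases ha with rfl | ha
    · exact Finset.mem_image_of_mem _ (Finset.mem_univ _)
    · obtain ⟨x, _, rfl⟩ := Finset.mem_image.mp ha
      by_cases hx : x = v
      -- The old profile of `v` is not lost: `u` still has it.
      · rw [hx, ← huv, show φ G' u = φ G'' u from (funext (h1 u hne)).symm]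
        exact Finset.mem_image_of_mem _ (Finset.mem_univ _)
      · rw [show φ G' x = φ G'' x from (funext (h1 x hx)).symm]
        exact Finset.mem_image_of_mem _ (Finset.mem_univ _)
  have hnot : φ G'' v ∉ Finset.univ.image (φ G') := by
    intro ha
    obtain ⟨x, _, hx⟩ := Finset.mem_image.mp ha
    by_cases hxv : x = v
    · rw [hxv, ← huv] at hx
      exact h2 u hne (congrFun hx.symm i₀)
    · exact h2 x hxv (congrFun hx.symm i₀)
  have := Finset.card_le_card hsub
  rw [Finset.card_insert_of_notMem hnot] at this
  omega

/-! ### Labelled solutions on `Fin n`. -/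

variable {n m : ℕ}

open Classical in
/-- The bit vector of a graph. -/
noncomputable def ofGraph (G : SimpleGraph (Fin n)) : EdgeVec n :=
  fun a => decide (G.Adj a.1.1 a.1.2)

theorem toGraph_ofGraph (G : SimpleGraph (Fin n)) : toGraph (ofGraph G) = G := by
  ext j k
  change adj (ofGraph G) j k = true ↔ G.Adj j k
  unfold adj mkEdge ofGraph
  by_cases h : j = k
  · subst h
    simp
  · by_cases hlt : j < k
    · simp [h, hlt]
    · simp [h, hlt, G.adj_comm]

open Classical in
/-- The set of solutions. -/
noncomputable def solutions (D : DistanceData n m) : Finset (EdgeVec n) :=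
  Finset.univ.filter (IsSolution D)

theorem mem_solutions (D : DistanceData n m) (e : EdgeVec n) :
    e ∈ solutions D ↔ IsSolution D e := by
  simp [solutions]

/-- An arbitrary numbering of `X` need not put the nodes first; it is corrected by a permutation
that extends the bijection between the two images of `Fin m`. -/
theorem DistanceData.Solvable.exists_graph {D : DistanceData n m} (hD : D.Solvable) :
    ∃ G : SimpleGraph (Fin n), ∀ i j, G.edist (obs D i) (obs D j) = (D.d₀ i j : ℕ∞) := by
  classical
  obtain ⟨X, _, E, b, hX, hE⟩ := hD
  let τ : X ≃ Fin n := Fintype.equivFinOfCardEq hX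
  let σ : Equiv.Perm (Fin n) := Equiv.extendSubtype (p := (· ∈ Set.range (obs D)))
    (q := (· ∈ Set.range (b.trans τ.toEmbedding)))
    ((Equiv.ofInjective _ (obs D).injective).symm.trans
      (Equiv.ofInjective _ (b.trans τ.toEmbedding).injective))
  have hσ : ∀ i, τ.symm (σ (obs D i)) = b i := by
    intro i
    rw [Equiv.symm_apply_eq]
    have := Equiv.extendSubtype_apply_of_mem (p := (· ∈ Set.range (obs D)))
      (q := (· ∈ Set.range (b.trans τ.toEmbedding)))
      ((Equiv.ofInjective _ (obs D).injective).symm.trans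
      (Equiv.ofInjective _ (b.trans τ.toEmbedding).injective)) (obs D i) ⟨i, rfl⟩
    refine this.trans ?_
    have h2 : (Equiv.ofInjective _ (obs D).injective).symm ⟨obs D i, ⟨i, rfl⟩⟩ = i :=
      Equiv.ofInjective_symm_apply _ i
    simp only [Equiv.trans_apply, h2]
    rfl
  refine ⟨E.comap (σ.trans τ.symm), fun i j => ?_⟩
  rw [← edist_iso (SimpleGraph.Iso.comap (σ.trans τ.symm) E)]
  simp only [SimpleGraph.Iso.comap_apply, Equiv.trans_apply, hσ, hE]

/-- Relabelling by a permutation `π` of the unobserved vertices gives `x` the profile that `π x` has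
in `G`. As profiles in `G` are distinct, the relabelled graph determines `π`. -/
theorem factorial_le_card_solutions {D : DistanceData n m} (hD : D.Solvable) :
    (n - m).factorial ≤ (solutions D).card := by
  classical
  have hm := D.four_le
  obtain ⟨G₀, hG₀⟩ := hD.exists_graph
  obtain ⟨G, hG, hinj⟩ := exists_graph_injective G₀ (obs D) ⟨0, by omega⟩ _ hG₀
  let p : Fin n → Prop := fun x => x ∉ Set.range (obs D)
  have hfix : ∀ (π : Equiv.Perm {x // p x}) (i : Fin m),
      Equiv.Perm.ofSubtype π (obs D i) = obs D i := fun π i =>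
    Equiv.Perm.ofSubtype_apply_of_not_mem π (by simp [p])
  have hedist : ∀ (π : Equiv.Perm {x // p x}) (x : Fin n) (i : Fin m),
      (G.comap (Equiv.Perm.ofSubtype π)).edist x (obs D i) =
        G.edist (Equiv.Perm.ofSubtype π x) (obs D i) := by
    intro π x i
    rw [← edist_iso (SimpleGraph.Iso.comap (Equiv.Perm.ofSubtype π) G)]
    simp only [SimpleGraph.Iso.comap_apply, hfix]
  have hcard : Fintype.card (Equiv.Perm {x // p x}) = (n - m).factorial := by
    rw [Fintype.card_perm, Fintype.card_subtype_compl]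
    congr 1
    rw [Fintype.card_fin]
    congr 1
    rw [Fintype.card_congr (Equiv.ofInjective _ (obs D).injective).symm, Fintype.card_fin]
  rw [← hcard, ← Finset.card_univ]
  refine Finset.card_le_card_of_injOn
    (fun π => ofGraph (G.comap (Equiv.Perm.ofSubtype π))) ?_ ?_
  · intro π _
    rw [Finset.mem_coe, mem_solutions]
    refine ⟨Fintype.card_fin n, fun i j => ?_⟩
    rw [toGraph_ofGraph, hedist, hfix, hG]
  · intro π _ π' _ h
    have h' := congrArg toGraph h
    simp only [toGraph_ofGraph] at h'
    apply Equiv.Perm.ofSubtype_injective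
    ext1 x
    refine hinj (funext fun i => ?_)
    simp only
    rw [← hedist, ← hedist, h']

end Count

/-! ### Analysis of Grover's iteration -/

section Grover

variable {n m : ℕ}

/-- The product state `v ⊗ κ`. -/
def prodState (v : EdgeVec n → ℂ) (κ : (Work n m → Bool) → ℂ) : QState (Qubit n m) :=
  fun x => v (fun a => x (.inl a)) * κ (fun q => x (.inr q))

theorem actOn_splitEdges_prodState (M : Matrix (EdgeVec n) (EdgeVec n) ℂ) (v : EdgeVec n → ℂ)
    (κ : (Work n m → Bool) → ℂ) :
    actOn (splitEdges n m) M (prodState v κ) = prodState (M.mulVec v) κ := by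
  funext x
  simp only [actOn, prodState, Matrix.mulVec, dotProduct, Finset.sum_mul]
  refine Finset.sum_congr rfl fun a _ => ?_
  rw [mul_assoc]
  rfl

/-- The state of the target `(|0⟩ - |1⟩)/√2` and of the ancillae `|0⋯0⟩`. -/
noncomputable def minusState (w : Work n m → Bool) : ℂ :=
  if ∀ q, q ≠ .R → w q = false then hadamard (w .R) true else 0

theorem hadamard_not_true (r : Bool) : hadamard (!r) true = -hadamard r true := by
  cases r <;> simp [hadamard]

theorem actOn_qR_initial :
    actOn (Equiv.funSplitAt (qR : Qubit n m) Bool) hadamard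
      ((Gate.not (qR : Qubit n m)).apply (ket fun _ => false)) =
      prodState (Pi.single (fun _ => false) 1) minusState := by
  funext x
  have key : ∀ a, ((Gate.not (qR : Qubit n m)).apply (ket fun _ => false))
      ((Equiv.funSplitAt (qR : Qubit n m) Bool).symm
        (a, ((Equiv.funSplitAt (qR : Qubit n m) Bool) x).2)) =
      if a = true ∧ ∀ q, q ≠ qR → x q = false then 1 else 0 := by
    intro a
    unfold Gate.apply ket
    rw [Pi.single_apply]
    congr 1
    rw [Gate.act_not, eq_iff_iff]
    constructor
    · intro h
      refine ⟨?_, fun q hq => ?_⟩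
      · simpa [Equiv.funSplitAt, Equiv.piSplitAt] using congrFun h qR
      · simpa [Equiv.funSplitAt, Equiv.piSplitAt, hq] using congrFun h q
    · rintro ⟨rfl, h⟩
      funext q
      by_cases hq : q = qR
      · subst hq
        simp [Equiv.funSplitAt, Equiv.piSplitAt]
      · simp [Equiv.funSplitAt, Equiv.piSplitAt, hq, h q hq]
  have h1 : ((Equiv.funSplitAt (qR : Qubit n m) Bool) x).1 = x qR := rfl
  have h2 : (∀ q, q ≠ qR → x q = false) ↔
      ((fun a => x (.inl a)) = fun _ => false) ∧ ∀ q, q ≠ Work.R → x (.inr q) = false := by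
    constructor
    · intro h
      refine ⟨funext fun a => h _ (by simp [qR]), fun q hq => h _ (by simpa [qR] using hq)⟩
    · rintro ⟨h, h'⟩ q hq
      rcases q with a | q
      · exact congrFun h a
      · exact h' q (by simpa [qR] using hq)
  simp only [actOn, key, h1, h2, prodState, minusState, Pi.single_apply, Fintype.sum_bool]
  by_cases ha : (fun a => x (.inl a)) = fun _ => false <;>
    by_cases hb : ∀ q, q ≠ Work.R → x (.inr q) = false <;> simp [ha, hb, qR]

theorem hadamardPow_mulVec_single :
    (hadamardPow (Edge n)).mulVec (Pi.single (fun _ => false) 1) = uniformState (Edge n) := by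
  funext x
  rw [Matrix.mulVec_single_one]
  simp only [Matrix.col_apply, hadamardPow, uniformState, hadamard, Bool.and_false, Bool.false_eq_true,
    if_false, Finset.prod_const, Finset.card_univ]
  rw [← Complex.ofReal_pow, div_pow, one_pow, Real.sqrt_eq_rpow, Real.sqrt_eq_rpow,
    ← Real.rpow_natCast, ← Real.rpow_natCast, ← Real.rpow_mul (by norm_num),
    ← Real.rpow_mul (by norm_num), mul_comm]

theorem initialState_eq : initialState n m = prodState (uniformState (Edge n)) minusState := by
  rw [initialState, actOn_qR_initial, actOn_splitEdges_prodState, hadamardPow_mulVec_single]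

theorem minusState_registerBits (m : ℕ) (e : EdgeVec n) (r : Bool) :
    minusState (fun q => registerBits m e r (.inr q)) = hadamard r true := by
  rw [minusState, if_pos]
  · rfl
  · intro q hq
    cases q <;> first | rfl | exact absurd rfl hq

theorem eq_registerBits_of_minusState_ne {x : Qubit n m → Bool}
    (h : minusState (fun q => x (.inr q)) ≠ 0) :
    x = registerBits m (fun a => x (.inl a)) (x qR) := by
  rw [minusState, ne_eq, ite_eq_right_iff, Classical.not_imp] at h
  funext q
  rcases q with a | (_ | ⟨d, i⟩ | i | i | i)
  · rfl
  · rfl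
  · exact h.1 _ (by simp)
  · exact h.1 _ (by simp)
  · exact h.1 _ (by simp)
  · exact h.1 _ (by simp)

theorem oracleCircuit_reverse_act (D : DistanceData n m) (e : EdgeVec n) (r : Bool) :
    Circuit.act (oracleCircuit D).reverse (registerBits m e r) =
      registerBits m e (xor r (classicalTest D e)) := by
  apply Circuit.act_reverse_eq
  rw [oracleCircuit_act]
  simp

/-- The oracle changes the sign of the solutions. -/
theorem oracle_run_prodState (D : DistanceData n m) (v : EdgeVec n → ℂ) :
    (oracleCircuit D).run (prodState v minusState) =
      prodState (fun e => if classicalTest D e then -v e else v e) minusState := by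
  funext x
  rw [Circuit.run_apply]
  by_cases hx : minusState (fun q => x (.inr q)) = 0
  -- For a string with dirty ancillae the circuit is not evaluated; its preimage is dirty too,
  -- because clean strings are sent to clean ones.
  · have h0 : minusState
        (fun q => Circuit.act (oracleCircuit D).reverse x (.inr q)) = 0 := by
      by_contra h
      have h1 := eq_registerBits_of_minusState_ne h
      have h2 := congrArg (Circuit.act (oracleCircuit D)) h1
      rw [Circuit.act_act_reverse, oracleCircuit_act] at h2
      rw [h2, minusState_registerBits] at hx
      revert hx
      generalize xor _ _ = r
      cases r <;> simp [hadamard]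
    simp only [prodState, hx, h0, mul_zero]
  · obtain ⟨e, r, rfl⟩ : ∃ e r, x = registerBits m e r :=
      ⟨_, _, eq_registerBits_of_minusState_ne hx⟩
    rw [oracleCircuit_reverse_act]
    simp only [prodState, minusState_registerBits]
    change v e * _ = (if classicalTest D e then -v e else v e) * _
    -- Phase kickback: flipping the target changes the sign of `(|0⟩ - |1⟩)/√2`.
    cases classicalTest D e
    · simp
    · simp [hadamard_not_true]

/-- Inversion about the mean of the coefficients. -/
theorem diffusionMatrix_mulVec (v : EdgeVec n → ℂ) :
    (diffusionMatrix (Edge n)).mulVec v =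
      fun e => 2 / (2 : ℂ) ^ edgeCount n * (∑ x, v x) - v e := by
  funext e
  have h0 : (0 : ℝ) ≤ 2 ^ edgeCount n := by positivity
  have h : ((1 / Real.sqrt (2 ^ edgeCount n) : ℝ) : ℂ) * ((1 / Real.sqrt (2 ^ edgeCount n) : ℝ) : ℂ)
      = 1 / (2 : ℂ) ^ edgeCount n := by
    rw [← Complex.ofReal_mul, div_mul_div_comm, Real.mul_self_sqrt h0]
    push_cast
    ring
  rw [diffusionMatrix, Matrix.sub_mulVec, Matrix.one_mulVec, Pi.sub_apply]
  congr 1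
  simp only [Matrix.mulVec, dotProduct, Matrix.smul_apply, Matrix.vecMulVec_apply, Pi.star_apply,
    uniformState, RCLike.star_def, Complex.conj_ofReal, card_edge, h, Finset.mul_sum]
  refine Finset.sum_congr rfl fun x _ => ?_
  rw [nsmul_eq_mul]
  push_cast
  ring

/-- The amplitudes of the solutions and of the other basis states after `L` iterations, as multiples
of the initial amplitude; `t` is the fraction of the solutions. -/
noncomputable def amplitudes (t : ℝ) : ℕ → ℝ × ℝ
  | 0 => (1, 1)
  | L + 1 =>
    let p := amplitudes t L
    (2 * ((1 - t) * p.2 - t * p.1) + p.1, 2 * ((1 - t) * p.2 - t * p.1) - p.2)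

/-- Each iteration is a rotation by `2θ` in the plane of the solution and non-solution components,
whose initial lengths are `sin θ` and `cos θ`. Avoiding division keeps the case `cos θ = 0`. -/
theorem amplitudes_eq {θ t : ℝ} (h : Real.sin θ ^ 2 = t) (L : ℕ) :
    Real.sin θ * (amplitudes t L).1 = Real.sin ((2 * L + 1) * θ) ∧
      Real.cos θ * (amplitudes t L).2 = Real.cos ((2 * L + 1) * θ) := by
  induction L with
  | zero => simp [amplitudes]
  | succ L ih =>
    obtain ⟨h1, h2⟩ := ih
    have hang : (2 * ((L + 1 : ℕ) : ℝ) + 1) * θ = (2 * L + 1) * θ + 2 * θ := by push_cast; ring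
    have hc : 1 - t = Real.cos θ ^ 2 := by rw [← h, Real.cos_sq']
    rw [hang, Real.sin_add, Real.cos_add, ← h1, ← h2, Real.sin_two_mul, Real.cos_two_mul]
    simp only [amplitudes]
    rw [hc, ← h]
    have hs := Real.sin_sq_add_cos_sq θ
    constructor
    · linear_combination (2 * Real.sin θ * (amplitudes (Real.sin θ ^ 2) L).1) * (-hs)
    · ring

/-- The amplitude vector after `L` iterations. -/
noncomputable def groverVector (D : DistanceData n m) (L : ℕ) (e : EdgeVec n) : ℂ :=
  let p := amplitudes ((solutions D).card / 2 ^ edgeCount n) L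
  ((1 / Real.sqrt (2 ^ edgeCount n) * (if classicalTest D e then p.1 else p.2) : ℝ) : ℂ)

theorem card_edgeVec : Fintype.card (EdgeVec n) = 2 ^ edgeCount n := by
  rw [Fintype.card_fun, Fintype.card_bool, card_edge]

theorem sum_ite_classicalTest (D : DistanceData n m) (a c : ℝ) :
    ∑ e, (if classicalTest D e then a else c) =
      (solutions D).card * a + (2 ^ edgeCount n - (solutions D).card) * c := by
  classical
  have hS : solutions D = Finset.univ.filter fun e => classicalTest D e = true := by
    ext e
    simp [mem_solutions, classicalTest_eq_true_iff]
  have h := Finset.card_filter_add_card_filter_not (s := (Finset.univ : Finset (EdgeVec n)))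
    (fun e => classicalTest D e = true)
  rw [Finset.card_univ, card_edgeVec] at h
  have h' : (((Finset.univ : Finset (EdgeVec n)).filter
      fun e => ¬ classicalTest D e = true).card : ℝ) = 2 ^ edgeCount n - (solutions D).card := by
    rw [hS, eq_sub_iff_add_eq, add_comm]
    exact_mod_cast h
  rw [Finset.sum_ite, Finset.sum_const, Finset.sum_const, nsmul_eq_mul, nsmul_eq_mul, h', hS]

/-- Invariant of the iteration: the work qubits never leave `minusState`, and the amplitude of an
edge vector depends only on whether it is a solution. -/
theorem groverState_eq (D : DistanceData n m) (L : ℕ) :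
    groverState D L = prodState (groverVector D L) minusState := by
  induction L with
  | zero =>
    rw [groverState, Function.iterate_zero, id, initialState_eq]
    congr 1
    funext e
    simp [uniformState, groverVector, amplitudes, card_edge]
  | succ L ih =>
    rw [groverState, Function.iterate_succ_apply', ← groverState, ih, groverStep,
      oracle_run_prodState, actOn_splitEdges_prodState, diffusionMatrix_mulVec]
    congr 1
    funext e
    set p := amplitudes ((solutions D).card / 2 ^ edgeCount n) L with hp
    set s := 1 / Real.sqrt (2 ^ edgeCount n) with hs
    have hv : ∀ x, (if classicalTest D x then -groverVector D L x else groverVector D L x) =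
        ((s * (if classicalTest D x then -p.1 else p.2) : ℝ) : ℂ) := by
      intro x
      simp only [groverVector, ← hp, ← hs]
      split_ifs <;> push_cast <;> ring
    have hN : (2 : ℝ) ^ edgeCount n ≠ 0 := by positivity
    simp only [hv]
    rw [← Complex.ofReal_sum, ← Finset.mul_sum, sum_ite_classicalTest]
    simp only [groverVector, ← hs, amplitudes, ← hp]
    have h2 : (2 : ℂ) / 2 ^ edgeCount n = ((2 / 2 ^ edgeCount n : ℝ) : ℂ) := by push_cast; rfl
    rw [h2, ← Complex.ofReal_mul, ← Complex.ofReal_sub]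
    congr 1
    split_ifs <;> field_simp <;> ring

/-- Read off from the normalization of the initial product state, whose other factor is uniform. -/
theorem sum_minusState : ∑ w : Work n m → Bool, ‖minusState w‖ ^ 2 = 1 := by
  have h : IsNormalized (initialState n m) := initialState_normalized
  have h0 : (0 : ℝ) ≤ 2 ^ edgeCount n := by positivity
  unfold IsNormalized at h
  rw [initialState_eq, ← (splitEdges n m).symm.sum_comp, Fintype.sum_prod_type] at h
  have h1 : ∀ (e : EdgeVec n) (w : Work n m → Bool),
      ‖prodState (uniformState (Edge n)) minusState ((splitEdges n m).symm (e, w))‖ ^ 2 =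
        1 / 2 ^ edgeCount n * ‖minusState w‖ ^ 2 := by
    intro e w
    change ‖uniformState (Edge n) e * minusState w‖ ^ 2 = _
    rw [norm_mul, mul_pow, uniformState, Complex.norm_real, Real.norm_eq_abs, sq_abs, div_pow,
      Real.sq_sqrt (by positivity), one_pow, card_edge]
  simp only [h1, ← Finset.mul_sum, Finset.sum_const, Finset.card_univ, card_edgeVec,
    nsmul_eq_mul] at h
  rw [← mul_assoc] at h
  push_cast at h
  rwa [one_div_mul_cancel (by positivity), one_mul] at h

theorem groverL_apply (D : DistanceData n m) (L : ℕ) (e : EdgeVec n) :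
    groverL D L e = ENNReal.ofReal (‖groverVector D L e‖ ^ 2) := by
  change ENNReal.ofReal (∑ w : Work n m → Bool, ‖groverState D L (Sum.elim e w)‖ ^ 2) = _
  congr 1
  rw [groverState_eq]
  have h1 : ∀ w : Work n m → Bool,
      ‖prodState (groverVector D L) minusState (Sum.elim e w)‖ ^ 2 =
        ‖groverVector D L e‖ ^ 2 * ‖minusState w‖ ^ 2 := by
    intro w
    change ‖groverVector D L e * minusState w‖ ^ 2 = _
    rw [norm_mul, mul_pow]
  simp only [h1, ← Finset.mul_sum, sum_minusState, mul_one]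

/-- The success probability of GROVER-L. -/
theorem groverL_success (D : DistanceData n m) (L : ℕ) {θ : ℝ}
    (hθ : Real.sin θ ^ 2 = (solutions D).card / 2 ^ edgeCount n) :
    (groverL D L).toOuterMeasure {e | classicalTest D e = true} =
      ENNReal.ofReal (Real.sin ((2 * L + 1) * θ) ^ 2) := by
  have hS : {e | classicalTest D e = true} = ((solutions D : Finset (EdgeVec n)) : Set _) := by
    ext e
    simp [mem_solutions, classicalTest_eq_true_iff]
  rw [hS, PMF.toOuterMeasure_apply_finset, ← (amplitudes_eq hθ L).1, mul_pow, hθ]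
  have h1 : ∀ e ∈ solutions D, groverL D L e = ENNReal.ofReal
      (1 / 2 ^ edgeCount n * (amplitudes ((solutions D).card / 2 ^ edgeCount n) L).1 ^ 2) := by
    intro e he
    rw [mem_solutions, ← classicalTest_eq_true_iff] at he
    rw [groverL_apply, groverVector]
    simp only [he, if_true]
    rw [Complex.norm_real, Real.norm_eq_abs, sq_abs, mul_pow, div_pow, one_pow,
      Real.sq_sqrt (by positivity)]
  rw [Finset.sum_congr rfl h1, Finset.sum_const, nsmul_eq_mul,
    ← ENNReal.ofReal_natCast, ← ENNReal.ofReal_mul (by positivity)]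
  congr 1
  ring

end Grover

/-! ### The algorithm -/

section Algorithm

variable {n m : ℕ}

theorem classicalTest_of_mem_support_attempts (D : DistanceData n m) (Ls : List ℕ) {r : Outcome n}
    (hr : r ∈ (attempts D Ls).support) {e : EdgeVec n} (he : r.output = some e) :
    classicalTest D e = true := by
  induction Ls generalizing r with
  | nil =>
    rw [attempts, PMF.mem_support_pure_iff] at hr
    subst hr
    cases he
  | cons L Ls ih =>
    rw [attempts, PMF.mem_support_bind_iff] at hr
    obtain ⟨e', _, hr⟩ := hr
    split_ifs at hr with h
    · rw [PMF.mem_support_pure_iff] at hr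
      subst hr
      cases he
      exact h
    · rw [PMF.mem_support_map_iff] at hr
      obtain ⟨r', hr', rfl⟩ := hr
      exact ih hr' he

/-- The number of queries of a run in which the listed values of `L` are used. -/
def totalCost (Ls : List ℕ) : ℕ := (Ls.map (· + 1)).sum

/-- If GROVER-L succeeds with probability at least `1/2`, then so does the algorithm, within the
queries made until the end of this attempt. -/
theorem attempts_success (D : DistanceData n m) (pre post : List ℕ) (L : ℕ)
    (hL : 1 / 2 ≤ (groverL D L).toOuterMeasure {e | classicalTest D e = true}) :
    1 / 2 ≤ (attempts D (pre ++ L :: post)).toOuterMeasure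
      {r | r.Finds D ∧ r.oracleQueries + r.testQueries ≤ totalCost pre + (L + 1)} := by
  induction pre with
  | nil =>
    refine hL.trans ?_
    rw [List.nil_append, attempts, PMF.toOuterMeasure_bind_apply, PMF.toOuterMeasure_apply]
    refine ENNReal.tsum_le_tsum fun e => ?_
    by_cases he : classicalTest D e = true
    · rw [Set.indicator_of_mem (show e ∈ {e | classicalTest D e = true} from he), if_pos he,
        PMF.toOuterMeasure_pure_apply, if_pos, mul_one]
      exact ⟨⟨e, rfl, (classicalTest_eq_true_iff D e).mp he⟩, by simp [totalCost]⟩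
    · rw [Set.indicator_of_notMem (show e ∉ {e | classicalTest D e = true} from he)]
      exact bot_le
  | cons L' pre ih =>
    rw [List.cons_append, attempts, PMF.toOuterMeasure_bind_apply]
    -- Conditioned on each result `e` of the earlier run, success within the budget has probability
    -- at least `1/2`: certain if `e` is accepted, by induction otherwise.
    have hsum : (1 / 2 : ENNReal) = ∑' e, groverL D L' e * (1 / 2) := by
      rw [ENNReal.tsum_mul_right, PMF.tsum_coe, one_mul]
    rw [hsum]
    refine ENNReal.tsum_le_tsum fun e => ?_
    gcongr
    split_ifs with he
    · rw [PMF.toOuterMeasure_pure_apply, if_pos]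
      · exact ENNReal.half_le_self
      · refine ⟨⟨e, rfl, (classicalTest_eq_true_iff D e).mp he⟩, ?_⟩
        simp only [totalCost, List.map_cons, List.sum_cons]
        omega
    · rw [PMF.toOuterMeasure_map_apply]
      refine ih.trans (MeasureTheory.measure_mono ?_)
      rintro r ⟨hr, hr'⟩
      refine ⟨hr, ?_⟩
      simp only [totalCost, List.map_cons, List.sum_cons] at hr' ⊢
      omega

theorem toOuterMeasure_add_compl {α : Type} (p : PMF α) (s : Set α) :
    p.toOuterMeasure s + p.toOuterMeasure sᶜ = 1 := by
  rw [PMF.toOuterMeasure_apply, PMF.toOuterMeasure_apply, ← ENNReal.tsum_add, ← p.tsum_coe]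
  refine tsum_congr fun a => ?_
  by_cases h : a ∈ s <;> simp [h]

/-- All runs must fail, and by independence the probabilities multiply. -/
theorem repeated_failure (D : DistanceData n m) (M : ℕ)
    (h : (algorithm D).toOuterMeasure {r | ¬ r.Finds D} ≤ 1 / 2) :
    (repeated D M).toOuterMeasure {rs | ¬ ∃ r ∈ rs, r.Finds D} ≤ (1 / 2) ^ M := by
  induction M with
  | zero =>
    rw [pow_zero]
    exact (MeasureTheory.measure_mono (Set.subset_univ _)).trans (by
      have := toOuterMeasure_add_compl (repeated D 0) Set.univ
      rw [← this]
      exact le_self_add)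
  | succ M ih =>
    rw [repeated, PMF.toOuterMeasure_bind_apply, pow_succ, mul_comm]
    refine le_trans ?_ (mul_le_mul' h ih)
    rw [PMF.toOuterMeasure_apply (algorithm D), ← ENNReal.tsum_mul_right]
    refine ENNReal.tsum_le_tsum fun r => ?_
    rw [PMF.toOuterMeasure_map_apply]
    by_cases hr : r.Finds D
    · have : (fun rs => r :: rs) ⁻¹' {rs | ¬ ∃ r ∈ rs, r.Finds D} = ∅ := by
        ext rs
        simp [hr]
      rw [this]
      simp
    · rw [Set.indicator_of_mem (show r ∈ {r : Outcome n | ¬ r.Finds D} from hr)]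
      gcongr
      intro rs hrs
      simpa [hr] using hrs

theorem repeated_success (D : DistanceData n m)
    (h : 1 / 2 ≤ (algorithm D).toOuterMeasure {r | r.Finds D}) {δ : ℝ} (hδ : δ ∈ Set.Ioo (0 : ℝ) 1)
    {M : ℕ} (hM : Real.logb 2 δ⁻¹ < M) :
    ENNReal.ofReal (1 - δ) < (repeated D M).toOuterMeasure {rs | ∃ r ∈ rs, r.Finds D} := by
  have hc := toOuterMeasure_add_compl (algorithm D) {r | r.Finds D}
  have hhalf : (1 / 2 : ENNReal) + 1 / 2 = 1 := ENNReal.add_halves 1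
  have h1 : (algorithm D).toOuterMeasure {r | ¬ r.Finds D} ≤ 1 / 2 := by
    by_contra hlt
    rw [not_le] at hlt
    have := ENNReal.add_lt_add_of_le_of_lt (by simp) h hlt
    rw [hhalf] at this
    exact absurd hc this.ne'
  have h2 := repeated_failure D M h1
  have h3 := toOuterMeasure_add_compl (repeated D M) {rs | ∃ r ∈ rs, r.Finds D}
  -- The strict inequality of the conclusion comes from here, that is, from `M > log₂ (1/δ)`.
  have h4 : (1 / 2 : ENNReal) ^ M < ENNReal.ofReal δ := by
    rw [Real.logb_lt_iff_lt_rpow (by norm_num) (inv_pos.mpr hδ.1), Real.rpow_natCast] at hM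
    have h5 : (1 / 2 : ℝ) ^ M < δ := by
      rw [one_div, inv_pow]
      exact inv_lt_of_inv_lt₀ hδ.1 hM
    have h6 : (1 / 2 : ENNReal) ^ M = ENNReal.ofReal ((1 / 2 : ℝ) ^ M) := by
      rw [ENNReal.ofReal_pow (by norm_num), ENNReal.ofReal_div_of_pos (by norm_num)]
      simp
    rw [h6]
    exact (ENNReal.ofReal_lt_ofReal_iff hδ.1).mpr h5
  have h7 : ENNReal.ofReal (1 - δ) + ENNReal.ofReal δ = 1 := by
    rw [← ENNReal.ofReal_add (by linarith [hδ.2]) hδ.1.le]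
    simp
  by_contra hle
  rw [not_lt] at hle
  have h8 := ENNReal.add_lt_add_of_le_of_lt
    (ne_top_of_le_ne_top ENNReal.ofReal_ne_top hle) hle (h2.trans_lt h4)
  rw [h7] at h8
  exact absurd h3 h8.ne

end Algorithm

/-! ### The query bound -/

section Bound

variable {n m : ℕ}

/-- For `x ≥ 1`, compare `x ^ x ≤ x ^ M` with the single term `x ^ M / M!` of the series of `exp x`;
for `x ≤ 1` the left side is at most `1`. -/
theorem div_exp_rpow_le_factorial {x : ℝ} {M : ℕ} (h0 : 0 ≤ x) (hx : x ≤ M) :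
    (x / Real.exp 1) ^ x ≤ M.factorial := by
  rcases le_total x 1 with h1 | h1
  · refine (Real.rpow_le_one (by positivity) ?_ h0).trans
      (by exact_mod_cast Nat.one_le_iff_ne_zero.mpr M.factorial_ne_zero)
    rw [div_le_one (Real.exp_pos 1)]
    exact h1.trans (Real.one_le_exp zero_le_one)
  · rw [Real.div_rpow h0 (Real.exp_pos 1).le, ← Real.exp_mul, one_mul,
      div_le_iff₀ (Real.exp_pos x)]
    have h2 := Real.pow_div_factorial_le_exp x h0 M
    rw [div_le_iff₀ (Nat.cast_pos.mpr M.factorial_pos)] at h2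
    calc x ^ x ≤ x ^ (M : ℝ) := Real.rpow_le_rpow_of_exponent_le h1 hx
      _ = x ^ M := Real.rpow_natCast x M
      _ ≤ Real.exp x * M.factorial := h2
      _ = M.factorial * Real.exp x := mul_comm _ _

/-- Since `√N ≤ n`, the exponent `x` of the bound is at most `n - m`, so `(x/e)^x ≤ (n-m)! ≤ K`; the
power `-1/2` reverses this. -/
theorem sqrt_le_queryBound {D : DistanceData n m} (hD : D.Solvable) :
    Real.sqrt (2 ^ edgeCount n / (solutions D).card) ≤ queryBound n m := by
  have hmn := D.m_le_n
  have hfac := factorial_le_card_solutions hD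
  have hK : (0 : ℝ) < (solutions D).card := by
    exact_mod_cast (Nat.factorial_pos _).trans_le hfac
  have hN : Real.sqrt (edgeCount n) ≤ n := by
    rw [Real.sqrt_le_left (by positivity)]
    have := two_mul_edgeCount n
    have h1 : n * (n - 1) ≤ n ^ 2 := by
      rw [sq]
      exact Nat.mul_le_mul_left _ (Nat.sub_le _ _)
    exact_mod_cast (show edgeCount n ≤ n ^ 2 by omega)
  unfold queryBound
  simp only
  set x : ℝ := max (Real.sqrt (edgeCount n) - m) 0 with hx
  have hx0 : 0 ≤ x := le_max_right _ _
  have hxM : x ≤ ((n - m : ℕ) : ℝ) := by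
    rw [Nat.cast_sub hmn]
    refine max_le (by linarith) ?_
    have : (m : ℝ) ≤ n := by exact_mod_cast hmn
    linarith
  have h1 : (x / Real.exp 1) ^ x ≤ (solutions D).card :=
    (div_exp_rpow_le_factorial hx0 hxM).trans (by exact_mod_cast hfac)
  have hpos : 0 < (x / Real.exp 1) ^ x := by
    -- At `x = 0` the base vanishes, but `0 ^ 0 = 1` keeps the power positive.
    rcases hx0.eq_or_lt with h | h
    · rw [← h]
      simp
    · exact Real.rpow_pos_of_pos (div_pos h (Real.exp_pos 1)) x
  have h2 : (x / Real.exp 1) ^ (-x / 2) = ((x / Real.exp 1) ^ x) ^ (-(1 / 2) : ℝ) := by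
    rw [← Real.rpow_mul (div_nonneg hx0 (Real.exp_pos 1).le)]
    congr 1
    ring
  have h3 : Real.sqrt (2 ^ edgeCount n / (solutions D).card) =
      (2 : ℝ) ^ ((edgeCount n : ℝ) / 2) * ((solutions D).card : ℝ) ^ (-(1 / 2) : ℝ) := by
    rw [Real.sqrt_div (by positivity), Real.sqrt_eq_rpow, Real.sqrt_eq_rpow, ← Real.rpow_natCast,
      ← Real.rpow_mul (by norm_num), Real.rpow_neg hK.le, div_eq_mul_inv]
    congr 2
    ring
  rw [h2, h3]
  exact mul_le_mul_of_nonneg_left (Real.rpow_le_rpow_of_nonpos hpos h1 (by norm_num))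
    (by positivity)

/-! ### The schedule -/

/-- The angle `θ` with `sin θ = √(2 ^ k / 2 ^ N)`. -/
noncomputable def powAngle (n k : ℕ) : ℝ :=
  Real.arcsin (Real.sqrt ((2 : ℝ) ^ k / (2 : ℝ) ^ edgeCount n))

theorem half_le_sin_sq {φ : ℝ} (h1 : Real.pi / 4 ≤ φ) (h2 : φ ≤ 3 * Real.pi / 4) :
    1 / 2 ≤ Real.sin φ ^ 2 := by
  have h := Real.cos_nonpos_of_pi_div_two_le_of_le (x := 2 * φ) (by linarith) (by linarith)
  rw [Real.sin_sq_eq_half_sub]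
  linarith

/-- With `s = sin² θ` one has `sin² (2θ) = 4s(1 - s)`, which exceeds `2s` for small `s > 0`. -/
theorem le_two_mul_of_sin_sq_le {a θ : ℝ} (h0 : 0 ≤ θ) (ha : a ≤ Real.pi / 2)
    (h1 : 0 < Real.sin θ ^ 2) (h2 : Real.sin θ ^ 2 ≤ 1 / 16)
    (h : Real.sin a ^ 2 ≤ 2 * Real.sin θ ^ 2) : a ≤ 2 * θ := by
  by_contra hlt
  rw [not_le] at hlt
  have hpi := Real.pi_pos
  have h3 : Real.sin (2 * θ) < Real.sin a :=
    Real.sin_lt_sin_of_lt_of_le_pi_div_two (by linarith) ha hlt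
  have h4 : 0 ≤ Real.sin (2 * θ) :=
    Real.sin_nonneg_of_nonneg_of_le_pi (by linarith) (by linarith)
  have h5 : Real.sin (2 * θ) ^ 2 < Real.sin a ^ 2 := pow_lt_pow_left₀ h3 h4 (by norm_num)
  rw [Real.sin_two_mul, mul_pow, mul_pow, Real.cos_sq'] at h5
  have h6 : 0 < Real.sin θ ^ 2 * (2 - 4 * Real.sin θ ^ 2) := mul_pos h1 (by linarith)
  linarith

theorem ratio_le {k : ℕ} (hk : k + 4 ≤ edgeCount n) :
    (2 : ℝ) ^ k / (2 : ℝ) ^ edgeCount n ≤ 1 / 16 := by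
  rw [div_le_div_iff₀ (by positivity) (by norm_num)]
  have h1 : (2 : ℝ) ^ (k + 4) ≤ 2 ^ edgeCount n := pow_le_pow_right₀ (by norm_num) hk
  rw [pow_add] at h1
  linarith

theorem sin_powAngle {k : ℕ} (hk : k + 4 ≤ edgeCount n) :
    Real.sin (powAngle n k) = Real.sqrt ((2 : ℝ) ^ k / (2 : ℝ) ^ edgeCount n) := by
  have h := ratio_le hk
  rw [powAngle, Real.sin_arcsin]
  · linarith [Real.sqrt_nonneg ((2 : ℝ) ^ k / (2 : ℝ) ^ edgeCount n)]
  · exact Real.sqrt_le_iff.mpr ⟨zero_le_one, by linarith⟩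

theorem sin_powAngle_sq {k : ℕ} (hk : k + 4 ≤ edgeCount n) :
    Real.sin (powAngle n k) ^ 2 = (2 : ℝ) ^ k / (2 : ℝ) ^ edgeCount n := by
  rw [sin_powAngle hk, Real.sq_sqrt (by positivity)]

theorem sin_powAngle_le {k : ℕ} (hk : k + 4 ≤ edgeCount n) : Real.sin (powAngle n k) ≤ 1 / 4 := by
  rw [sin_powAngle hk, Real.sqrt_le_left (by norm_num)]
  have := ratio_le hk
  linarith

theorem powAngle_pos {k : ℕ} : 0 < powAngle n k := by
  rw [powAngle, Real.arcsin_pos]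
  positivity

/-- Jordan's inequality gives `sin (π/8) > 1/4`. Hence every scheduled angle falls into the first
branch of `iterations`. -/
theorem powAngle_lt {k : ℕ} (hk : k + 4 ≤ edgeCount n) : powAngle n k < Real.pi / 8 := by
  have hpi := Real.pi_pos
  have h1 : 2 / Real.pi * (Real.pi / 8) < Real.sin (Real.pi / 8) :=
    Real.mul_lt_sin (by positivity) (by linarith)
  have h2 : 2 / Real.pi * (Real.pi / 8) = 1 / 4 := by field_simp; norm_num
  have h3 := sin_powAngle_le hk
  by_contra h
  rw [not_lt] at h
  have h4 : Real.sin (Real.pi / 8) ≤ Real.sin (powAngle n k) :=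
    Real.sin_le_sin_of_le_of_le_pi_div_two (by linarith) (Real.arcsin_le_pi_div_two _) h
  linarith

/-- The ceiling selects the first `L` that reaches the angle `π/2`; rounding up overshoots by at
most one step `2θ`. -/
theorem iterations_bounds {k : ℕ} (hk : k + 4 ≤ edgeCount n) :
    Real.pi / 2 ≤ (2 * iterations (powAngle n k) + 1) * powAngle n k ∧
      (2 * iterations (powAngle n k) + 1) * powAngle n k ≤ Real.pi / 2 + 2 * powAngle n k := by
  have h0 := powAngle_pos (n := n) (k := k)
  have h1 := powAngle_lt hk
  set θ := powAngle n k
  have hL : iterations θ = ⌈Real.pi / (4 * θ) - 1 / 2⌉₊ := by rw [iterations, if_pos h1]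
  have hq : 2 < Real.pi / (4 * θ) := by
    rw [lt_div_iff₀ (by positivity)]
    linarith
  have h2 := Nat.le_ceil (Real.pi / (4 * θ) - 1 / 2)
  have h3 := Nat.ceil_lt_add_one (a := Real.pi / (4 * θ) - 1 / 2) (by linarith)
  rw [← hL] at h2 h3
  have hθ : Real.pi / (4 * θ) * θ = Real.pi / 4 := by field_simp
  constructor <;> nlinarith

/-- From `(2L - 1)θ ≤ π/2` and `sin θ ≤ θ` follows `2(L + 1) sin θ ≤ π/2 + 3 sin θ ≤ π/2 + 3/4 < 4`.
-/
theorem iterations_cost {k : ℕ} (hk : k + 4 ≤ edgeCount n) :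
    (iterations (powAngle n k) : ℝ) + 1 ≤
      2 * Real.sqrt ((2 : ℝ) ^ edgeCount n / (2 : ℝ) ^ k) := by
  have h0 := powAngle_pos (n := n) (k := k)
  have h1 := (iterations_bounds hk).2
  have h2 := Real.sin_le h0.le
  have h3 := sin_powAngle_le hk
  have h4 : Real.sqrt ((2 : ℝ) ^ edgeCount n / (2 : ℝ) ^ k) = (Real.sin (powAngle n k))⁻¹ := by
    rw [sin_powAngle hk, ← Real.sqrt_inv, inv_div]
  have h5 : 0 < Real.sin (powAngle n k) := by
    rw [sin_powAngle hk]
    positivity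
  rw [h4]
  set θ := powAngle n k
  set L : ℝ := (iterations θ : ℝ) with hL
  have hL0 : 0 ≤ L := by positivity
  have h6 : (2 * L - 1) * θ ≤ Real.pi / 2 := by linarith
  have hpi := Real.pi_lt_d2
  rw [← div_eq_mul_inv, le_div_iff₀ h5]
  rcases le_total (2 * L - 1) 0 with h7 | h7
  · nlinarith
  · have h8 : (2 * L - 1) * Real.sin θ ≤ (2 * L - 1) * θ := mul_le_mul_of_nonneg_left h2 h7
    nlinarith

theorem sum_geometric_le (b : ℕ) : ∑ i ∈ Finset.range b, (3 / 4 : ℝ) ^ i ≤ 4 := by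
  have h : ∑ i ∈ Finset.range b, (3 / 4 : ℝ) ^ i = 4 * (1 - (3 / 4) ^ b) := by
    induction b with
    | zero => simp
    | succ b ih =>
      rw [Finset.sum_range_succ, ih, pow_succ]
      ring
  rw [h]
  have : (0 : ℝ) ≤ (3 / 4) ^ b := by positivity
  linarith

/-- Doubling `K` divides the cost bound by `√2`; the ratio `1/√2` is replaced by `3/4`, as `1/2 ≤
9/16`, so the series sums to at most `4`. -/
theorem sum_cost_le {j b : ℕ} (hb : j + b + 4 ≤ edgeCount n + 1) :
    ∑ i ∈ Finset.range b, ((iterations (powAngle n (j + i)) : ℝ) + 1) ≤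
      8 * Real.sqrt ((2 : ℝ) ^ edgeCount n / (2 : ℝ) ^ j) := by
  set S := Real.sqrt ((2 : ℝ) ^ edgeCount n / (2 : ℝ) ^ j) with hS
  have h1 : ∀ i, Real.sqrt ((2 : ℝ) ^ edgeCount n / (2 : ℝ) ^ (j + i)) ≤ S * (3 / 4) ^ i := by
    intro i
    rw [Real.sqrt_le_left (by positivity), mul_pow, hS, Real.sq_sqrt (by positivity), pow_add,
      ← div_div, div_eq_mul_inv _ ((2 : ℝ) ^ i), ← inv_pow, ← pow_mul, mul_comm i 2, pow_mul]
    gcongr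
    norm_num
  calc ∑ i ∈ Finset.range b, ((iterations (powAngle n (j + i)) : ℝ) + 1)
      ≤ ∑ i ∈ Finset.range b, 2 * S * (3 / 4 : ℝ) ^ i := by
        refine Finset.sum_le_sum fun i hi => ?_
        rw [Finset.mem_range] at hi
        have := iterations_cost (n := n) (k := j + i) (by omega)
        linarith [h1 i]
    _ = 2 * S * ∑ i ∈ Finset.range b, (3 / 4 : ℝ) ^ i := by rw [Finset.mul_sum]
    _ ≤ 2 * S * 4 := by
        gcongr
        exact sum_geometric_le b
    _ = 8 * S := by ring

theorem sum_map_range (g : ℕ → ℕ) (b : ℕ) :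
    ((List.range b).map g).sum = ∑ i ∈ Finset.range b, g i := by
  induction b with
  | zero => simp
  | succ b ih => simp [List.range_succ, Finset.sum_range_succ, ih]

/-- The schedule descends in `k`, so the cheaper bounds for larger `k` come first and the last run
dominates. The `6 = 1 + 2 + 3` pays for `L = 0, 1, 2`. -/
theorem schedule_split {j : ℕ} (hj : j + 4 ≤ edgeCount n) : ∃ pre post,
    schedule n = pre ++ iterations (powAngle n j) :: post ∧
      ((totalCost pre + (iterations (powAngle n j) + 1) : ℕ) : ℝ) ≤
        6 + 8 * Real.sqrt ((2 : ℝ) ^ edgeCount n / (2 : ℝ) ^ j) := by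
  obtain ⟨b, hb⟩ : ∃ b, edgeCount n - 3 = (j + 1) + b := ⟨edgeCount n - 3 - (j + 1), by omega⟩
  let f : ℕ → ℕ := fun k => iterations (powAngle n k)
  refine ⟨[0, 1, 2] ++ ((List.range b).map (j + 1 + ·)).reverse.map f,
    (List.range j).reverse.map f, ?_, ?_⟩
  · have : schedule n = [0, 1, 2] ++ (List.range (edgeCount n - 3)).reverse.map f := rfl
    rw [this, hb, List.range_add, List.range_succ, List.reverse_append, List.reverse_append,
      List.map_append, List.map_append, List.append_assoc]
    rfl
  · have hsum := sum_cost_le (n := n) (j := j) (b := b + 1) (by omega)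
    have hpre : totalCost ([0, 1, 2] ++ ((List.range b).map (j + 1 + ·)).reverse.map f) =
        6 + ∑ i ∈ Finset.range b, (f (j + (i + 1)) + 1) := by
      rw [totalCost, List.map_append, List.sum_append, List.map_map, List.map_reverse,
        List.sum_reverse, List.map_map, sum_map_range]
      congr 1
      refine Finset.sum_congr rfl fun i _ => ?_
      simp only [Function.comp_apply]
      rw [show j + 1 + i = j + (i + 1) by ring]
    rw [Finset.sum_range_succ'] at hsum
    rw [hpre]
    push_cast
    simp only [f, add_zero] at hsum ⊢
    linarith

set_option maxHeartbeats 1000000 in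
/-- If there is a solution, then some attempt of the schedule that comes early enough succeeds with
probability at least `1/2`. -/
theorem exists_attempt {D : DistanceData n m} (hD : D.Solvable) : ∃ pre L post,
    schedule n = pre ++ L :: post ∧
      1 / 2 ≤ (groverL D L).toOuterMeasure {e | classicalTest D e = true} ∧
      ((totalCost pre + (L + 1) : ℕ) : ℝ) ≤ 14 * queryBound n m := by
  have hQ := sqrt_le_queryBound hD
  have hn : 6 ≤ edgeCount n := by
    have h1 := two_mul_edgeCount n
    have h2 : 4 ≤ n := D.four_le.trans D.m_le_n
    have h3 : 4 * 3 ≤ n * (n - 1) := Nat.mul_le_mul h2 (by omega)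
    omega
  have hK1 : 1 ≤ (solutions D).card :=
    (Nat.succ_le_of_lt (Nat.factorial_pos _)).trans (factorial_le_card_solutions hD)
  have hK2 : (solutions D).card ≤ 2 ^ edgeCount n := by
    rw [← card_edgeVec]
    exact Finset.card_le_univ _
  set K := (solutions D).card with hK
  have hK1' : (1 : ℝ) ≤ K := by exact_mod_cast hK1
  have hK2' : (K : ℝ) ≤ 2 ^ edgeCount n := by exact_mod_cast hK2
  set θ := Real.arcsin (Real.sqrt (K / 2 ^ edgeCount n)) with hθ
  have hratio : (K : ℝ) / 2 ^ edgeCount n ≤ 1 := by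
    rw [div_le_one (by positivity)]
    exact hK2'
  have hsin : Real.sin θ = Real.sqrt (K / 2 ^ edgeCount n) := by
    rw [hθ, Real.sin_arcsin]
    · linarith [Real.sqrt_nonneg (K / 2 ^ edgeCount n)]
    · exact Real.sqrt_le_iff.mpr ⟨zero_le_one, by rwa [one_pow]⟩
  have hsq : Real.sin θ ^ 2 = K / 2 ^ edgeCount n := by
    rw [hsin, Real.sq_sqrt (by positivity)]
  have hθ0 : 0 < θ := by
    rw [hθ, Real.arcsin_pos]
    positivity
  have hθ1 : θ ≤ Real.pi / 2 := Real.arcsin_le_pi_div_two _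
  have hpi := Real.pi_gt_three
  have hpi' := Real.pi_lt_d2
  have hQ1 : 1 ≤ queryBound n m := by
    refine le_trans ?_ hQ
    rw [Real.one_le_sqrt, one_le_div (by positivity)]
    exact hK2'
  have hsucc : ∀ L : ℕ, Real.pi / 4 ≤ (2 * L + 1) * θ → (2 * L + 1) * θ ≤ 3 * Real.pi / 4 →
      1 / 2 ≤ (groverL D L).toOuterMeasure {e | classicalTest D e = true} := by
    intro L h1 h2
    rw [groverL_success D L hsq]
    have h3 : (1 / 2 : ENNReal) = ENNReal.ofReal (1 / 2) := by
      rw [ENNReal.ofReal_div_of_pos (by norm_num)]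
      simp
    rw [h3]
    exact ENNReal.ofReal_le_ofReal (half_le_sin_sq h1 h2)
  by_cases hbig : 2 ^ (edgeCount n - 4) ≤ K
  · have hsin4 : 1 / 4 ≤ Real.sin θ := by
      rw [hsin]
      apply Real.le_sqrt_of_sq_le
      rw [le_div_iff₀ (by positivity)]
      have h1 : (2 : ℝ) ^ (edgeCount n - 4) ≤ K := by exact_mod_cast hbig
      have h2 : (2 : ℝ) ^ edgeCount n = 2 ^ (edgeCount n - 4) * 2 ^ 4 := by
        rw [← pow_add]
        congr 1
        omega
      rw [h2]
      linarith
    have hlow : 1 / 4 ≤ θ := hsin4.trans (Real.sin_le hθ0.le)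
    -- The windows `π/4 ≤ (2L+1)θ ≤ 3π/4` for `L = 0, 1, 2` cover `[1/4, π/2]`; the cuts are at
    -- `π/4` and `π/12`, and `5/4 ≥ π/4` at the lower end.
    rcases le_total (Real.pi / 4) θ with h1 | h1
    · refine ⟨[], 0, _, rfl, hsucc 0 ?_ ?_, ?_⟩
      · push_cast; linarith
      · push_cast; linarith
      · simp only [totalCost, List.map_nil, List.sum_nil]
        push_cast
        linarith
    rcases le_total (Real.pi / 12) θ with h2 | h2
    · refine ⟨[0], 1, _, rfl, hsucc 1 ?_ ?_, ?_⟩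
      · push_cast; linarith
      · push_cast; linarith
      · simp only [totalCost, List.map_nil, List.sum_nil, List.map_cons, List.sum_cons]
        push_cast
        linarith
    · refine ⟨[0, 1], 2, _, rfl, hsucc 2 ?_ ?_, ?_⟩
      · push_cast; linarith
      · push_cast; linarith
      · simp only [totalCost, List.map_nil, List.sum_nil, List.map_cons, List.sum_cons]
        push_cast
        linarith
  · rw [not_le] at hbig
    -- The run used is the one for `2 ^ (k + 1)`, the power above `K`, so that its cost is bounded
    -- in terms of `K` without loss.
    set k := Nat.log 2 K with hk
    have hk1 : 2 ^ k ≤ K := Nat.pow_log_le_self 2 (by omega)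
    have hk2 : K < 2 ^ (k + 1) := Nat.lt_pow_succ_log_self (by norm_num) K
    have hk3 : k < edgeCount n - 4 := (Nat.pow_lt_pow_iff_right (by norm_num)).mp (hk1.trans_lt hbig)
    have hj : (k + 1) + 4 ≤ edgeCount n := by omega
    have hk1' : (2 : ℝ) ^ k ≤ K := by exact_mod_cast hk1
    have hk2' : (K : ℝ) ≤ 2 ^ (k + 1) := by exact_mod_cast hk2.le
    obtain ⟨pre, post, hs, hcost⟩ := schedule_split hj
    refine ⟨pre, _, post, hs, ?_, ?_⟩
    · have hj0 := powAngle_pos (n := n) (k := k + 1)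
      have hj1 := powAngle_lt hj
      obtain ⟨hb1, hb2⟩ := iterations_bounds hj
      have hle : θ ≤ powAngle n (k + 1) := by
        refine Real.arcsin_le_arcsin (Real.sqrt_le_sqrt ?_)
        gcongr
      have hsq' := sin_powAngle_sq hj
      have hrat := ratio_le hj
      have hsin2 : Real.sin (powAngle n (k + 1)) ^ 2 ≤ 2 * Real.sin θ ^ 2 := by
        rw [hsq', hsq, ← mul_div_assoc]
        gcongr
        rw [pow_succ]
        linarith
      have hge : powAngle n (k + 1) ≤ 2 * θ := by
        refine le_two_mul_of_sin_sq_le hθ0.le (by linarith) ?_ ?_ hsin2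
        · rw [hsq]
          positivity
        · rw [hsq]
          refine le_trans ?_ hrat
          gcongr
      -- For `θ' = powAngle n (k + 1)` and `θ ≤ θ' ≤ 2θ`, the bounds `π/2 ≤ (2L+1)θ' ≤ π/2 + 2θ'`
      -- with `θ' < π/8` put `(2L+1)θ` into `[π/4, 3π/4]`.
      apply hsucc
      · have : (2 * (iterations (powAngle n (k + 1)) : ℝ) + 1) * powAngle n (k + 1) ≤
            (2 * (iterations (powAngle n (k + 1)) : ℝ) + 1) * (2 * θ) :=
          mul_le_mul_of_nonneg_left hge (by positivity)
        linarith
      · have : (2 * (iterations (powAngle n (k + 1)) : ℝ) + 1) * θ ≤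
            (2 * (iterations (powAngle n (k + 1)) : ℝ) + 1) * powAngle n (k + 1) :=
          mul_le_mul_of_nonneg_left hle (by positivity)
        linarith
    · refine hcost.trans ?_
      have h1 : Real.sqrt ((2 : ℝ) ^ edgeCount n / (2 : ℝ) ^ (k + 1)) ≤
          Real.sqrt (2 ^ edgeCount n / K) := by
        apply Real.sqrt_le_sqrt
        gcongr
      linarith

end Bound
end TravelTime

theorem theorem3p1 :
    ∃ C : ℝ, 0 < C ∧ ∀ (n m : ℕ) (D : TravelTime.DistanceData n m),
      -- every output of the algorithm is correct
      (∀ r ∈ (TravelTime.algorithm D).support, ∀ e, r.output = some e →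
        TravelTime.IsSolution D e) ∧
      (D.Solvable →
        -- success probability and number of queries of one run
        (1 / 2 : ENNReal) ≤ (TravelTime.algorithm D).toOuterMeasure
          {r | r.Finds D ∧
            ((r.oracleQueries + r.testQueries : ℕ) : ℝ) ≤ C * TravelTime.queryBound n m} ∧
        -- success probability of `M` runs
        ∀ δ ∈ Set.Ioo (0 : ℝ) 1, ∀ M : ℕ, Real.logb 2 δ⁻¹ < M →
          ENNReal.ofReal (1 - δ) < (TravelTime.repeated D M).toOuterMeasure
            {rs | ∃ r ∈ rs, r.Finds D}) ∧
      -- the circuit ORACLE is a quantum oracle for the set of solutions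
      (∀ g ∈ TravelTime.oracleCircuit D, g.WellFormed) ∧
      (∀ (e : TravelTime.EdgeVec n) (r : Bool),
        (TravelTime.oracleCircuit D).run (TravelTime.ket (TravelTime.registerBits m e r)) =
          TravelTime.ket (TravelTime.registerBits m e (xor r (TravelTime.solutionBit D e)))) ∧
      -- its number of qubits
      (Fintype.card (TravelTime.Qubit n m) : ℝ) ≤ C * TravelTime.edgeCount n ∧
      (Fintype.card (TravelTime.Qubit n m) : ℝ) ≤ C * (n : ℝ) ^ 2 ∧
      -- its number of gates
      ((TravelTime.oracleCircuit D).length : ℝ) ≤ C * m * (n : ℝ) ^ 3 := by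
  open TravelTime in
  -- The gate count dictates the constant; queries need only `14` and qubits only `6`.
  refine ⟨100, by norm_num, fun n m D => ⟨?_, ?_, oracleCircuit_wellFormed D, ?_, ?_, ?_, ?_⟩⟩
  · intro r hr e he
    exact (classicalTest_eq_true_iff D e).mp (classicalTest_of_mem_support_attempts D _ hr he)
  · intro hD
    obtain ⟨pre, L, post, hs, hL, hcost⟩ := exists_attempt hD
    have hmain := attempts_success D pre post L hL
    rw [← hs] at hmain
    have hQ : 0 ≤ queryBound n m := (Real.sqrt_nonneg _).trans (sqrt_le_queryBound hD)
    refine ⟨hmain.trans (MeasureTheory.measure_mono ?_), fun δ hδ M hM =>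
      repeated_success D (hmain.trans (MeasureTheory.measure_mono ?_)) hδ hM⟩
    · rintro r ⟨hr, hr'⟩
      refine ⟨hr, ?_⟩
      have h1 : ((r.oracleQueries + r.testQueries : ℕ) : ℝ) ≤
          ((totalCost pre + (L + 1) : ℕ) : ℝ) := by exact_mod_cast hr'
      linarith
    · exact fun r hr => hr.1
  · intro e r
    rw [Circuit.run_ket, oracleCircuit_act, solutionBit_eq]
  · have h := (card_qubit_le D).1
    have h' : (Fintype.card (Qubit n m) : ℝ) ≤ 6 * edgeCount n := by exact_mod_cast h
    have : (0 : ℝ) ≤ edgeCount n := by positivity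
    linarith
  · have h := (card_qubit_le D).2
    have h' : (Fintype.card (Qubit n m) : ℝ) ≤ 6 * (n : ℝ) ^ 2 := by exact_mod_cast h
    have : (0 : ℝ) ≤ (n : ℝ) ^ 2 := by positivity
    linarith
  · exact_mod_cast oracleCircuit_length_le D
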